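/- Let $K$ be an algebraically closed field of characteristic $0$, let $A,B,C$ be three non-collinear points of $\mathbb P^2=\mathbb P^2_K$, and let $a,b,c$ be natural numbers. Let $\mathrm{Tr}(a,b,c)$ be the set of arrangements $\mathcal A$ of finitely many distinct lines of $\mathbb P^2$ such that every line of $\mathcal A$ passes through $A$, $B$ or $C$, the three side lines $AB$, $AC$, $BC$ belong to $\mathcal A$, and exactly $a+1$, $b+1$, $c+1$ lines of $\mathcal A$ pass through $A$, $B$, $C$ respectively (so $a,b,c\ge 1$ if there is such an arrangement, and $\mathcal A$ has $a+b+c$ lines). If $f=0$ is an equation of the union of the lines of $\mathcal A$, let $\mathcal T_{\mathcal A}$ be the kernel of the Jacobian map $(\partial_xf,\partial_yf,\partial_zf):\mathcal O_{\mathbb P^2}^3\to\mathcal O_{\mathbb P^2}(a+b+c-1)$; call $\mathcal T_{\mathcal A}$ free with exponents $(d_1,d_2)\in\mathbb Z^2$ if $\mathcal T_{\mathcal A}\cong\mathcal O_{\mathbb P^2}(-d_1)\oplus\mathcal O_{\mathbb P^2}(-d_2)$. Let $T$ be the set of inner triple points of $\mathcal A$, that is, of the points other than $A,B,C$ lying on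 exactly three lines of $\mathcal A$. A finite set of points of $\mathbb P^2$ is called a complete intersection of type $(m,n)$ if its homogeneous ideal in $K[x,y,z]$ is generated by two forms of degrees $m$ and $n$ (the ideal of the empty set being the unit ideal). 1. For every $\mathcal A\in\mathrm{Tr}(a,b,c)$, the bundle $\mathcal T_{\mathcal A}$ is free with exponents $(a+b-1,c)$ if and only if $T$ is a complete intersection of type $(a-1,b-1)$. 2. This is the most unbalanced splitting possible: for every $\mathcal A\in\mathrm{Tr}(a,b,c)$ one has $|T|\le (a-1)(b-1)$, and if $\mathcal T_{\mathcal A}$ is free with exponents $(d_1,d_2)$, then $|d_1-d_2|\le|a+b-1-c|$. Moreover, if $a,b\ge 1$, $a\le c$ and $b\le c$, then some $\mathcal A\in\mathrm{Tr}(a,b,c)$ is free with exponents $(a+b-1,c)$. -/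

import Mathlib

open MvPolynomial
open scoped LinearAlgebra.Projectivization

noncomputable section

namespace TriangularArrangement

/-! ### The projective plane and its twisted structure sheaves -/

/-- The projective plane over `K`, as the set of lines through the origin of `K³`.
It carries the Zariski topology, see below. -/
def Plane (K : Type*) [Field K] : Type _ := ℙ K (Fin 3 → K)

variable {K : Type*} [Field K]

/-- The homogeneous coordinates of the points of `U`: the punctured affine cone over `U`. -/
def cone (U : Set (Plane K)) : Set (Fin 3 → K) :=
  {v | ∃ hv : v ≠ 0, Projectivization.mk K v hv ∈ U}

theorem cone_mono {U V : Set (Plane K)} (h : V ⊆ U) : cone V ⊆ cone U :=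
  fun _ hv => ⟨hv.1, h hv.2⟩

/-- The set of points of the plane at which the form `F` does not vanish. -/
def basicOpen (F : MvPolynomial (Fin 3) K) : Set (Plane K) :=
  {p | eval (Projectivization.rep p) F ≠ 0}

/-- The Zariski topology of the projective plane. -/
instance : TopologicalSpace (Plane K) :=
  TopologicalSpace.generateFrom
    {U | ∃ (n : ℕ) (F : MvPolynomial (Fin 3) K), F.IsHomogeneous n ∧ U = basicOpen F}

open TopologicalSpace (Opens)

/-- `IsRegularSection d U s` says that `s` is a section of `𝒪(d)` over `U`: a function on the
punctured cone over `U` which is, locally on `U`, a quotient of two forms whose degrees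
differ by `d`. -/
def IsRegularSection (d : ℤ) (U : Opens (Plane K)) (s : cone (U : Set (Plane K)) → K) : Prop :=
  ∀ x ∈ U, ∃ V : Opens (Plane K), x ∈ V ∧
    ∃ (m n : ℕ) (P Q : MvPolynomial (Fin 3) K),
      P.IsHomogeneous m ∧ Q.IsHomogeneous n ∧ (m : ℤ) = n + d ∧
        ∀ v : cone (U : Set (Plane K)), v.1 ∈ cone (V : Set (Plane K)) →
          eval v.1 Q ≠ 0 ∧ s v = eval v.1 P / eval v.1 Q

theorem IsRegularSection.zero (d : ℤ) (U : Opens (Plane K)) :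
    IsRegularSection d U (0 : cone (U : Set (Plane K)) → K) := by
  intro x _
  rcases le_total 0 d with h | h
  · exact ⟨⊤, trivial, d.toNat, 0, 0, 1, isHomogeneous_zero _ _ _, isHomogeneous_one _ _,
      by simp [h], fun v _ => by simp⟩
  · -- here the denominator is a power of a coordinate that does not vanish at `x`
    obtain ⟨i, hi⟩ : ∃ i, Projectivization.rep x i ≠ 0 := by
      by_contra! hx
      exact Projectivization.rep_nonzero x (funext hx)
    have hhom : (X i : MvPolynomial (Fin 3) K).IsHomogeneous 1 := isHomogeneous_X _ _
    refine ⟨⟨basicOpen (X i), TopologicalSpace.isOpen_generateFrom_of_mem ⟨1, _, hhom, rfl⟩⟩,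
      by simpa [basicOpen] using hi, 0, (-d).toNat, 0, X i ^ (-d).toNat,
      isHomogeneous_zero _ _ _, by simpa using hhom.pow (-d).toNat, by simp [h], ?_⟩
    rintro v ⟨hv, hv'⟩
    have hv'' : Projectivization.rep (Projectivization.mk K v.1 hv) i ≠ 0 := by
      have h' : eval (Projectivization.rep (Projectivization.mk K v.1 hv))
        (X i : MvPolynomial (Fin 3) K) ≠ 0 := hv'
      rwa [eval_X] at h'
    obtain ⟨a, ha⟩ := Projectivization.exists_smul_eq_mk_rep K v.1 hv
    rw [← ha] at hv''
    have : v.1 i ≠ 0 := fun h0 => hv'' (by simp [h0])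
    simp [this]

theorem IsRegularSection.one (U : Opens (Plane K)) :
    IsRegularSection 0 U (1 : cone (U : Set (Plane K)) → K) := fun _ _ =>
  ⟨⊤, trivial, 0, 0, 1, 1, isHomogeneous_one _ _, isHomogeneous_one _ _, by simp,
    fun v _ => by simp⟩

theorem IsRegularSection.add {d : ℤ} {U : Opens (Plane K)}
    {s t : cone (U : Set (Plane K)) → K}
    (hs : IsRegularSection d U s) (ht : IsRegularSection d U t) :
    IsRegularSection d U (s + t) := by
  intro x hx
  obtain ⟨V, hxV, m, n, P, Q, hP, hQ, h, H⟩ := hs x hx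
  obtain ⟨V', hxV', m', n', P', Q', hP', hQ', h', H'⟩ := ht x hx
  refine ⟨V ⊓ V', ⟨hxV, hxV'⟩, m + n', n + n', P * Q' + Q * P', Q * Q', ?_, hQ.mul hQ',
    by push_cast; omega, fun v hv => ?_⟩
  · have e : n + m' = m + n' := by omega
    exact (hP.mul hQ').add (e ▸ hQ.mul hP')
  · obtain ⟨h1, h2⟩ := H v (cone_mono (fun _ hp => hp.1) hv)
    obtain ⟨h1', h2'⟩ := H' v (cone_mono (fun _ hp => hp.2) hv)
    refine ⟨by simp [h1, h1'], ?_⟩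
    simp only [Pi.add_apply, h2, h2', map_add, map_mul]
    field_simp

theorem IsRegularSection.mul {d e : ℤ} {U : Opens (Plane K)}
    {s t : cone (U : Set (Plane K)) → K}
    (hs : IsRegularSection d U s) (ht : IsRegularSection e U t) :
    IsRegularSection (d + e) U (s * t) := by
  intro x hx
  obtain ⟨V, hxV, m, n, P, Q, hP, hQ, h, H⟩ := hs x hx
  obtain ⟨V', hxV', m', n', P', Q', hP', hQ', h', H'⟩ := ht x hx
  refine ⟨V ⊓ V', ⟨hxV, hxV'⟩, m + m', n + n', P * P', Q * Q', hP.mul hP', hQ.mul hQ',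
    by push_cast; omega, fun v hv => ?_⟩
  obtain ⟨h1, h2⟩ := H v (cone_mono (fun _ hp => hp.1) hv)
  obtain ⟨h1', h2'⟩ := H' v (cone_mono (fun _ hp => hp.2) hv)
  refine ⟨by simp [h1, h1'], ?_⟩
  simp only [Pi.mul_apply, h2, h2', map_mul]
  field_simp

theorem IsRegularSection.neg {d : ℤ} {U : Opens (Plane K)}
    {s : cone (U : Set (Plane K)) → K} (hs : IsRegularSection d U s) :
    IsRegularSection d U (-s) := by
  intro x hx
  obtain ⟨V, hxV, m, n, P, Q, hP, hQ, h, H⟩ := hs x hx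
  refine ⟨V, hxV, m, n, -P, Q, hP.neg, hQ, h, fun v hv => ⟨(H v hv).1, ?_⟩⟩
  simp [(H v hv).2, neg_div]

/-- The ring `𝒪(U)` of regular functions on the open set `U` of the plane, seen as functions
on the punctured cone over `U`. -/
def regularFunctions (U : Opens (Plane K)) : Subring (cone (U : Set (Plane K)) → K) where
  carrier := {s | IsRegularSection 0 U s}
  mul_mem' hs ht := IsRegularSection.mul hs ht
  one_mem' := IsRegularSection.one U
  add_mem' hs ht := IsRegularSection.add hs ht
  zero_mem' := IsRegularSection.zero 0 U
  neg_mem' hs := IsRegularSection.neg hs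

/-- The `𝒪(U)`-module of sections over `U` of the line bundle `𝒪(d)`. -/
def lineBundle (d : ℤ) (U : Opens (Plane K)) :
    Submodule (regularFunctions U) (cone (U : Set (Plane K)) → K) where
  carrier := {s | IsRegularSection d U s}
  add_mem' hs ht := IsRegularSection.add hs ht
  zero_mem' := IsRegularSection.zero d U
  smul_mem' r s hs := by
    have h := IsRegularSection.mul r.2 hs
    rw [zero_add] at h
    exact h

/-- Restriction to a smaller open set of functions on the punctured cone. -/
def restrict {U V : Opens (Plane K)} (h : V ≤ U) (s : cone (U : Set (Plane K)) → K) :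
    cone (V : Set (Plane K)) → K :=
  fun v => s ⟨v.1, cone_mono h v.2⟩

theorem IsRegularSection.restrict {d : ℤ} {U V : Opens (Plane K)} (h : V ≤ U)
    {s : cone (U : Set (Plane K)) → K} (hs : IsRegularSection d U s) :
    IsRegularSection d V (restrict h s) := by
  intro x hx
  obtain ⟨W, hxW, m, n, P, Q, hP, hQ, e, H⟩ := hs x (h hx)
  exact ⟨W, hxW, m, n, P, Q, hP, hQ, e, fun v hv => H ⟨v.1, cone_mono h v.2⟩ hv⟩

/-- The restriction map of `𝒪`. -/
def resFunctions {U V : Opens (Plane K)} (h : V ≤ U) (s : regularFunctions U) :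
    regularFunctions V :=
  ⟨restrict h s.1, IsRegularSection.restrict h s.2⟩

/-- The restriction map of `𝒪(d)`. -/
def resLineBundle {d : ℤ} {U V : Opens (Plane K)} (h : V ≤ U) (s : lineBundle d U) :
    lineBundle d V :=
  ⟨restrict h s.1, IsRegularSection.restrict h s.2⟩

/-! ### The logarithmic bundle of a line arrangement -/

/-- The Jacobian map `(θ₀, θ₁, θ₂) ↦ θ₀ ∂₀f + θ₁ ∂₁f + θ₂ ∂₂f` on the sections of `𝒪³` over `U`.
If `f` is a form of degree `n`, its values are sections of `𝒪(n - 1)`, here seen as functions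
on the punctured cone over `U`. -/
def jacobianMap (f : MvPolynomial (Fin 3) K) (U : Opens (Plane K)) :
    (Fin 3 → regularFunctions U) →ₗ[regularFunctions U] (cone (U : Set (Plane K)) → K) where
  toFun θ v := ∑ i, (θ i).1 v * eval v.1 (pderiv i f)
  map_add' θ η := by
    funext v
    simp [add_mul, Finset.sum_add_distrib]
  map_smul' r θ := by
    funext v
    change _ = r.1 v * _
    simp [Finset.mul_sum, mul_assoc]

/-- The sections over `U` of the kernel of the Jacobian map of `f`. -/
def logSheaf (f : MvPolynomial (Fin 3) K) (U : Opens (Plane K)) :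
    Submodule (regularFunctions U) (Fin 3 → regularFunctions U) :=
  LinearMap.ker (jacobianMap f U)

/-- The restriction map of the kernel of the Jacobian map. -/
def resLogSheaf {f : MvPolynomial (Fin 3) K} {U V : Opens (Plane K)} (h : V ≤ U)
    (θ : logSheaf f U) : logSheaf f V :=
  ⟨fun i => resFunctions h (θ.1 i), LinearMap.mem_ker.mpr <| funext fun v =>
    congrFun (LinearMap.mem_ker.mp θ.2) ⟨v.1, cone_mono h v.2⟩⟩

/-- An isomorphism of sheaves of `𝒪`-modules from `𝒪(-d₁) ⊕ 𝒪(-d₂)` to the kernel of the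
Jacobian map of `f`. -/
structure Splitting (f : MvPolynomial (Fin 3) K) (d₁ d₂ : ℤ) where
  /-- The isomorphism on sections over `U`. -/
  equiv (U : Opens (Plane K)) :
    (lineBundle (-d₁) U × lineBundle (-d₂) U) ≃ₗ[regularFunctions U] logSheaf f U
  /-- Compatibility with restrictions. -/
  equiv_res {U V : Opens (Plane K)} (h : V ≤ U) (s : lineBundle (-d₁) U × lineBundle (-d₂) U) :
    equiv V (resLineBundle h s.1, resLineBundle h s.2) = resLogSheaf h (equiv U s)

/-- A line of the plane, given by its coefficients up to a common factor: the point `p` lies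
on the line `l` when `l₀ p₀ + l₁ p₁ + l₂ p₂ = 0`. -/
abbrev Line (K : Type*) [Field K] : Type _ := ℙ K (Fin 3 → K)

/-- The point `p` lies on the line `l`. -/
def OnLine (p : Plane K) (l : Line K) : Prop := Projectivization.orthogonal l p

/-- An equation of the line `l`: a linear form, well defined up to a nonzero constant. -/
def Line.equation (l : Line K) : MvPolynomial (Fin 3) K :=
  ∑ i, C (l.rep i) * X i

/-- An equation of the line arrangement `𝒜`, well defined up to a nonzero constant. -/
def arrangementEquation (𝒜 : Finset (Line K)) : MvPolynomial (Fin 3) K :=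
  ∏ l ∈ 𝒜, Line.equation l

/-- The arrangement `𝒜` is free with exponents `(d₁, d₂)`: its logarithmic bundle is isomorphic
to `𝒪(-d₁) ⊕ 𝒪(-d₂)`. -/
def IsFreeWithExponents (𝒜 : Finset (Line K)) (d₁ d₂ : ℤ) : Prop :=
  Nonempty (Splitting (arrangementEquation 𝒜) d₁ d₂)

/-! ### Triangular arrangements and their inner triple points -/

/-- The number of lines of `𝒜` through the point `p`. -/
def multiplicity (𝒜 : Finset (Line K)) (p : Plane K) : ℕ :=
  {l | l ∈ 𝒜 ∧ OnLine p l}.ncard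

/-- The set `Tr(a, b, c)` of complete triangular arrangements with vertices `A`, `B`, `C`. -/
def Tr (A B C : Plane K) (a b c : ℕ) : Set (Finset (Line K)) :=
  {𝒜 | (∀ l ∈ 𝒜, OnLine A l ∨ OnLine B l ∨ OnLine C l) ∧
    (∀ l, (OnLine A l ∧ OnLine B l) ∨ (OnLine A l ∧ OnLine C l) ∨ (OnLine B l ∧ OnLine C l) →
      l ∈ 𝒜) ∧
    multiplicity 𝒜 A = a + 1 ∧ multiplicity 𝒜 B = b + 1 ∧ multiplicity 𝒜 C = c + 1}

/-- The triple points of `𝒜` other than the vertices `A`, `B`, `C`. -/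
def innerTriplePoints (A B C : Plane K) (𝒜 : Finset (Line K)) : Set (Plane K) :=
  {p | p ≠ A ∧ p ≠ B ∧ p ≠ C ∧ multiplicity 𝒜 p = 3}

/-- The finite set of points `T` is a complete intersection of type `(m, n)`: its homogeneous
ideal is generated by two forms of degrees `m` and `n`. (For `T` nonempty these two forms
are automatically coprime, since `T` is finite; the ideal of the empty set is the unit ideal.) -/
def IsCompleteIntersection (T : Set (Plane K)) (m n : ℕ) : Prop :=
  ∃ F G : MvPolynomial (Fin 3) K, F.IsHomogeneous m ∧ G.IsHomogeneous n ∧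
    vanishingIdeal K (cone T) = Ideal.span {F, G}

end TriangularArrangement

end

/-!
Let `x`, `y`, `z` be equations of the sides of the triangle, let `F`, `G`, `H` be the products of
the equations of the inner lines through its three vertices, so that
`deg F = a - 1`, `deg G = b - 1`, `deg H = c - 1`, and let `f = x y z F G H`.

*From vector fields to syzygies.* A polynomial vector field `θ` which annihilates `f` is tangent
to every line of the arrangement. For the sides this reads `θ x = x p`, `θ y = y q`, `θ z = z r`,
and for the other lines, which have equations such as `α y + β z`, it reads `F ∣ q - r`,
`G ∣ r - p` and `H ∣ p - q`. Since `(q - r) + (r - p) + (p - q) = 0`, the quotients form a syzygy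
of `F`, `G`, `H`. In characteristic `0` the Euler field can be used to correct a tangent field to
one that annihilates `f`, so that this is an isomorphism from the graded module of fields
annihilating `f` to the module of syzygies (`exists_isRelated_of_annihilates`,
`IsSyzygy.exists_isRelated`, `eq_zero_of_isRelated_zero`).

*From sheaves to graded modules.* The polynomial ring is factorial, so the sections of `𝒪(d)` over
the whole plane, and therefore the morphisms between the line bundles, are given by forms
(`exists_isForm_of_locally_quotient`, `exists_isForm_of_morphism`). Hence a splitting of the
logarithmic bundle amounts to a homogeneous basis of the graded module
(`Splitting.exists_isGeneratingPair`, `IsGeneratingPair.nonempty_splitting`).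

*The exponents.* If the syzygies are generated by two homogeneous ones, their `2 × 2` minors are
`F`, `G`, `H` up to a constant, as in the Hilbert–Burch theorem (`exists_minors_eq`); this gives
`d₁ + d₂ = a + b + c - 1`. A syzygy whose degree is less than `c` has last coefficient `0`, hence
is a multiple of `(G, -F, 0)`, of degree `a + b - 1`. So `d₁` and `d₂` are at least
`min (a + b - 1) c`, which bounds `|d₁ - d₂|`. Exponents `(a + b - 1, c)` force one of the two
generators to have a nonzero constant as last coefficient, that is, `H ∈ (F, G)`; conversely, if
`H = F s + G t`, the syzygies `(G, -F, 0)` and `(s, t, -1)` form a basis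
(`H_mem_of_isGeneratingPair`, `nonempty_splitting_of_H_mem`).

*The triple points.* The inner triple points are the points `F = G = 0` of the grid in which `H`
vanishes. The ideal `(F, G)` is the ideal of the whole grid (`mem_span_F_G`). If `H ∈ (F, G)`, all
points of the grid are triple points, and they form the complete intersection `F = G = 0`.
Conversely, if the ideal of the triple points is generated by forms of degrees `a - 1` and
`b - 1`, then it is `(F, G)`, because it contains the coprime forms `F` and `G` of the same
degrees, and it contains `H` (`isCompleteIntersection_of_H_mem`,
`H_mem_of_isCompleteIntersection`).

*Existence.* The lines `y = s z`, `z = t x` and `x = r y`, where `s`, `t`, `r` are roots of unity of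
a fixed order, together with arbitrary further lines `x = r y`, give arrangements with
`H ∈ (F, G)` (`exists_triangleData_H_mem`).
-/

noncomputable section

namespace TriangularArrangement

open TopologicalSpace (Opens)

variable {K : Type*} [Field K]

/-! ### Forms of integral degree -/

/-- `p` is a form of degree `n`, where `n` is an integer: the only form of negative degree
is `0`. -/
def IsForm (n : ℤ) (p : MvPolynomial (Fin 3) K) : Prop :=
  ∀ d, coeff d p ≠ 0 → (d.degree : ℤ) = n

theorem isForm_natCast {n : ℕ} {p : MvPolynomial (Fin 3) K} :
    IsForm (n : ℤ) p ↔ p.IsHomogeneous n := by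
  simp only [IsForm, IsHomogeneous, IsWeightedHomogeneous, Finsupp.degree_eq_weight_one]
  norm_cast

theorem IsForm.eq_zero_of_neg {n : ℤ} {p : MvPolynomial (Fin 3) K} (h : IsForm n p)
    (hn : n < 0) : p = 0 := by
  ext d
  by_contra hd
  have := h d (by simpa using hd)
  omega

theorem IsForm.exists_nat {n : ℤ} {p : MvPolynomial (Fin 3) K} (h : IsForm n p)
    (hp : p ≠ 0) : ∃ k : ℕ, (k : ℤ) = n ∧ p.IsHomogeneous k := by
  have hn : 0 ≤ n := by
    by_contra hn
    exact hp (h.eq_zero_of_neg (by omega))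
  lift n to ℕ using hn
  exact ⟨n, rfl, isForm_natCast.mp h⟩

theorem IsForm.zero (n : ℤ) : IsForm n (0 : MvPolynomial (Fin 3) K) := fun d hd => by simp at hd

theorem IsForm.add {n : ℤ} {p q : MvPolynomial (Fin 3) K} (hp : IsForm n p) (hq : IsForm n q) :
    IsForm n (p + q) := fun d hd => by
  by_cases h : coeff d p = 0
  · exact hq d (by simpa [h] using hd)
  · exact hp d h

theorem IsForm.neg {n : ℤ} {p : MvPolynomial (Fin 3) K} (hp : IsForm n p) : IsForm n (-p) :=
  fun d hd => hp d (by simpa using hd)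

theorem IsForm.sub {n : ℤ} {p q : MvPolynomial (Fin 3) K} (hp : IsForm n p) (hq : IsForm n q) :
    IsForm n (p - q) := by
  rw [sub_eq_add_neg]
  exact hp.add hq.neg

theorem IsForm.mul {m n : ℤ} {p q : MvPolynomial (Fin 3) K} (hp : IsForm m p)
    (hq : IsForm n q) : IsForm (m + n) (p * q) := by
  rcases eq_or_ne p 0 with rfl | hp0
  · rw [zero_mul]; exact IsForm.zero _
  rcases eq_or_ne q 0 with rfl | hq0
  · rw [mul_zero]; exact IsForm.zero _
  obtain ⟨k, rfl, hk⟩ := hp.exists_nat hp0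
  obtain ⟨l, rfl, hl⟩ := hq.exists_nat hq0
  exact_mod_cast isForm_natCast.mpr (hk.mul hl)

theorem IsForm.sum {ι : Type*} (s : Finset ι) {n : ℤ} {p : ι → MvPolynomial (Fin 3) K}
    (h : ∀ i ∈ s, IsForm n (p i)) : IsForm n (∑ i ∈ s, p i) := by
  classical
  induction s using Finset.induction_on with
  | empty => simpa using IsForm.zero n
  | insert i s hi ih =>
    rw [Finset.sum_insert hi]
    exact (h i (by simp)).add (ih fun j hj => h j (by simp [hj]))

theorem IsForm.congr {m n : ℤ} {p : MvPolynomial (Fin 3) K} (h : IsForm m p) (e : m = n) :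
    IsForm n p := e ▸ h

theorem IsForm.C (r : K) : IsForm 0 (C r : MvPolynomial (Fin 3) K) := by
  exact_mod_cast isForm_natCast.mpr (isHomogeneous_C _ r)

/-- A form of degree `0` is a constant. -/
theorem IsForm.eq_C {p : MvPolynomial (Fin 3) K} (h : IsForm 0 p) :
    p = MvPolynomial.C (coeff 0 p) := by
  have h' : p.IsHomogeneous 0 := isForm_natCast.mp (by exact_mod_cast h)
  rw [← totalDegree_zero_iff_isHomogeneous, totalDegree_eq_zero_iff_eq_C] at h'
  exact h'

/-- The homogeneous component of `p` of degree `n`, which is `0` if `n` is negative. -/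
def formComponent (n : ℤ) : MvPolynomial (Fin 3) K →ₗ[K] MvPolynomial (Fin 3) K :=
  if 0 ≤ n then homogeneousComponent n.toNat else 0

theorem formComponent_natCast (n : ℕ) :
    (formComponent n : MvPolynomial (Fin 3) K →ₗ[K] _) = homogeneousComponent n := by
  simp [formComponent]

theorem formComponent_of_neg {n : ℤ} (hn : n < 0) (p : MvPolynomial (Fin 3) K) :
    formComponent n p = 0 := by
  simp [formComponent, not_le.mpr hn]

theorem isForm_formComponent (n : ℤ) (p : MvPolynomial (Fin 3) K) :
    IsForm n (formComponent n p) := by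
  rcases lt_or_ge n 0 with h | h
  · rw [formComponent_of_neg h]
    exact IsForm.zero n
  · lift n to ℕ using h
    rw [formComponent_natCast, isForm_natCast]
    exact homogeneousComponent_isHomogeneous n p

theorem IsForm.formComponent_eq {n : ℤ} {p : MvPolynomial (Fin 3) K} (h : IsForm n p) :
    formComponent n p = p := by
  rcases eq_or_ne p 0 with rfl | h0
  · simp
  obtain ⟨k, rfl, hk⟩ := h.exists_nat h0
  rw [formComponent_natCast, homogeneousComponent_eq_self hk]

attribute [local instance] MvPolynomial.gradedAlgebra in
theorem formComponent_mul {m : ℤ} {p : MvPolynomial (Fin 3) K} (hp : IsForm m p) (n : ℤ)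
    (q : MvPolynomial (Fin 3) K) :
    formComponent n (p * q) = p * formComponent (n - m) q := by
  rcases eq_or_ne p 0 with rfl | h0
  · simp
  obtain ⟨k, rfl, hk⟩ := hp.exists_nat h0
  have key (i : ℕ) (r : MvPolynomial (Fin 3) K) :
      homogeneousComponent i r = DirectSum.decompose (homogeneousSubmodule (Fin 3) K) r i :=
    (decomposition.decompose'_apply r i).symm
  rcases lt_or_ge n 0 with h | h
  · rw [formComponent_of_neg h, formComponent_of_neg (by omega), mul_zero]
  lift n to ℕ using h
  rw [formComponent_natCast, key]
  rcases le_or_gt k n with hkn | hkn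
  · have e : (n : ℤ) - k = (n - k : ℕ) := by omega
    rw [DirectSum.coe_decompose_mul_of_left_mem_of_le _ hk hkn, e, formComponent_natCast, key]
  · rw [DirectSum.coe_decompose_mul_of_left_mem_of_not_le _ hk (not_le.mpr hkn),
      formComponent_of_neg (by omega), mul_zero]

/-- A cofactor of a nonzero form in a form is a form. -/
theorem IsForm.of_mul {m n : ℤ} {p q : MvPolynomial (Fin 3) K} (hp : IsForm m p) (h0 : p ≠ 0)
    (h : IsForm (m + n) (p * q)) : IsForm n q := by
  have := h.formComponent_eq
  rw [formComponent_mul hp, add_sub_cancel_left] at this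
  rw [← mul_left_cancel₀ h0 this]
  exact isForm_formComponent _ _

/-- The substitution `Xᵢ ↦ Xᵢ T`; it sends `p` to `p Tⁿ` exactly when `p` is a form of
degree `n`. -/
def scaling : MvPolynomial (Fin 3) K →ₐ[K] Polynomial (MvPolynomial (Fin 3) K) :=
  aeval fun i => Polynomial.C (X i) * Polynomial.X

theorem scaling_monomial (d : Fin 3 →₀ ℕ) (r : K) :
    scaling (monomial d r) = Polynomial.monomial d.degree (monomial d r) := by
  rw [scaling, aeval_monomial, ← Polynomial.C_mul_X_pow_eq_monomial]
  simp only [mul_pow]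
  rw [Finsupp.prod_mul, ← mul_assoc]
  congr 1
  · rw [monomial_eq, map_mul, Finsupp.prod, Finsupp.prod, map_prod]
    simp
  · rw [Finsupp.prod, Finset.prod_pow_eq_pow_sum]
    rfl

theorem coeff_scaling (p : MvPolynomial (Fin 3) K) (n : ℕ) :
    (scaling p).coeff n = homogeneousComponent n p := by
  induction p using MvPolynomial.induction_on' with
  | monomial d r =>
    rw [scaling_monomial, Polynomial.coeff_monomial, homogeneousComponent_of_mem
      (isHomogeneous_monomial r rfl)]
    simp [eq_comm]
  | add p q hp hq => simp [hp, hq]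

/-- The factors of a nonzero form are forms. -/
theorem exists_isHomogeneous_of_mul {n : ℕ} {p q : MvPolynomial (Fin 3) K}
    (h : (p * q).IsHomogeneous n) (h0 : p * q ≠ 0) : ∃ k, q.IsHomogeneous k := by
  have hp0 : p ≠ 0 := left_ne_zero_of_mul h0
  have hq0 : q ≠ 0 := right_ne_zero_of_mul h0
  have inj : ∀ r : MvPolynomial (Fin 3) K, r ≠ 0 → scaling r ≠ 0 := by
    intro r hr hs
    apply hr
    rw [← sum_homogeneousComponent r]
    refine Finset.sum_eq_zero fun i _ => ?_
    rw [← coeff_scaling, hs, Polynomial.coeff_zero]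
  have hm : scaling p * scaling q = Polynomial.monomial n (p * q) := by
    rw [← map_mul]
    ext1 i
    rw [coeff_scaling, homogeneousComponent_of_mem h, Polynomial.coeff_monomial]
    simp [eq_comm]
  have h1 := Polynomial.natDegree_mul (inj p hp0) (inj q hq0)
  have h2 := Polynomial.natTrailingDegree_mul (inj p hp0) (inj q hq0)
  rw [hm, Polynomial.natDegree_monomial_eq _ h0] at h1
  rw [hm, Polynomial.natTrailingDegree_monomial h0] at h2
  have h3 := Polynomial.natTrailingDegree_le_natDegree (scaling p)
  have h4 := Polynomial.natTrailingDegree_le_natDegree (scaling q)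
  refine ⟨(scaling q).natDegree, ?_⟩
  have : homogeneousComponent (scaling q).natDegree q = q := by
    refine Eq.trans (Eq.symm ?_) (sum_homogeneousComponent q)
    by_cases hmem : (scaling q).natDegree < q.totalDegree + 1
    · refine Finset.sum_eq_single_of_mem _ (Finset.mem_range.mpr hmem) fun j _ hj => ?_
      rw [← coeff_scaling]
      rcases lt_or_gt_of_ne hj with hj | hj
      · exact Polynomial.coeff_eq_zero_of_lt_natTrailingDegree (by omega)
      · exact Polynomial.coeff_eq_zero_of_natDegree_lt hj
    · exfalso
      have := Polynomial.leadingCoeff_ne_zero.mpr (inj q hq0)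
      rw [Polynomial.leadingCoeff, coeff_scaling] at this
      exact this (homogeneousComponent_eq_zero _ _ (by omega))
  have h5 := homogeneousComponent_isHomogeneous (scaling q).natDegree q
  rwa [this] at h5

theorem eval_smul_of_isHomogeneous {n : ℕ} {p : MvPolynomial (Fin 3) K} (h : p.IsHomogeneous n)
    (r : K) (v : Fin 3 → K) : eval (r • v) p = r ^ n * eval v p := by
  rw [eval_eq', eval_eq', Finset.mul_sum]
  refine Finset.sum_congr rfl fun d hd => ?_
  have hd' : ∑ i, d i = n := by
    rw [← Finsupp.degree_eq_sum, Finsupp.degree_eq_weight_one]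
    exact h (mem_support_iff.mp hd)
  simp only [Pi.smul_apply, smul_eq_mul, mul_pow, Finset.prod_mul_distrib,
    Finset.prod_pow_eq_pow_sum, hd']
  ring

/-- Over an algebraically closed field a form without a nontrivial zero is constant. -/
theorem degree_eq_zero_of_forall_eval_ne_zero [IsAlgClosed K] {n : ℕ}
    {p : MvPolynomial (Fin 3) K} (h : p.IsHomogeneous n)
    (hp : ∀ v : Fin 3 → K, v ≠ 0 → eval v p ≠ 0) : n = 0 := by
  by_contra hn
  -- the restriction of `p` to the affine line of points `(T, 1, 0)` has no zero
  let q : Polynomial K := aeval ![Polynomial.X, 1, 0] p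
  have hq : ∀ t : K, q.eval t = eval ![t, 1, 0] p := by
    intro t
    have : (Polynomial.aeval t).comp (aeval ![Polynomial.X, 1, 0]) =
        (aeval ![t, 1, 0] : MvPolynomial (Fin 3) K →ₐ[K] K) := by
      ext i
      fin_cases i <;> simp
    have h' := DFunLike.congr_fun this p
    simpa [q, aeval_eq_eval, Polynomial.aeval_def] using h'
  have hdeg : q.degree = 0 := by
    by_contra hdeg
    obtain ⟨t, ht⟩ := IsAlgClosed.exists_root q hdeg
    exact hp ![t, 1, 0] (fun h0 => one_ne_zero (congrFun h0 1)) (by rw [← hq]; exact ht)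
  rw [Polynomial.eq_C_of_degree_eq_zero hdeg] at hq
  -- so `p (1, s, 0) = sⁿ p (s⁻¹, 1, 0)` is a multiple of `sⁿ`, which contradicts `p (1, 0, 0) ≠ 0`
  let r : Polynomial K := aeval ![1, Polynomial.X, 0] p
  have hr : ∀ s : K, r.eval s = eval ![1, s, 0] p := by
    intro s
    have : (Polynomial.aeval s).comp (aeval ![1, Polynomial.X, 0]) =
        (aeval ![1, s, 0] : MvPolynomial (Fin 3) K →ₐ[K] K) := by
      ext i
      fin_cases i <;> simp
    have h' := DFunLike.congr_fun this p
    simpa [r, aeval_eq_eval, Polynomial.aeval_def] using h'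
  have hrq : r * Polynomial.X = Polynomial.C (q.coeff 0) * Polynomial.X ^ n * Polynomial.X := by
    refine Polynomial.funext fun s => ?_
    simp only [Polynomial.eval_mul, Polynomial.eval_X, Polynomial.eval_C, Polynomial.eval_pow, hr]
    rcases eq_or_ne s 0 with rfl | hs
    · simp
    · have e : (![1, s, 0] : Fin 3 → K) = s • ![s⁻¹, 1, 0] := by
        ext i
        fin_cases i <;> simp [hs]
      have := hq s⁻¹
      rw [Polynomial.eval_C] at this
      rw [e, eval_smul_of_isHomogeneous h, this]
      ring
  have := congrArg (Polynomial.eval 0) (mul_right_cancel₀ Polynomial.X_ne_zero hrq)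
  simp only [hr, Polynomial.eval_mul, Polynomial.eval_pow, Polynomial.eval_X, zero_pow hn,
    mul_zero] at this
  exact hp ![1, 0, 0] (fun h0 => one_ne_zero (congrFun h0 0)) this

/-! ### Open subsets of the projective plane -/

theorem mem_cone_basicOpen {n : ℕ} {F : MvPolynomial (Fin 3) K} (hF : F.IsHomogeneous n)
    {v : Fin 3 → K} : v ∈ cone (basicOpen F) ↔ v ≠ 0 ∧ eval v F ≠ 0 := by
  have key : ∀ hv : v ≠ 0, Projectivization.mk K v hv ∈ basicOpen F ↔ eval v F ≠ 0 := by
    intro hv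
    obtain ⟨r, hr⟩ := Projectivization.exists_smul_eq_mk_rep K v hv
    change eval (Projectivization.mk K v hv).rep F ≠ 0 ↔ _
    rw [← hr, Units.smul_def, eval_smul_of_isHomogeneous hF]
    simp
  exact ⟨fun ⟨hv, h⟩ => ⟨hv, (key hv).mp h⟩, fun ⟨hv, h⟩ => ⟨hv, (key hv).mpr h⟩⟩

theorem isOpen_basicOpen {n : ℕ} {F : MvPolynomial (Fin 3) K} (hF : F.IsHomogeneous n) :
    IsOpen (basicOpen F) :=
  TopologicalSpace.isOpen_generateFrom_of_mem ⟨n, F, hF, rfl⟩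

/-- The sets `basicOpen F` form a basis of the Zariski topology. -/
theorem exists_basicOpen_subset {U : Set (Plane K)} (hU : IsOpen U) {x : Plane K} (hx : x ∈ U) :
    ∃ (n : ℕ) (F : MvPolynomial (Fin 3) K), F.IsHomogeneous n ∧ x ∈ basicOpen F ∧
      basicOpen F ⊆ U := by
  induction hU with
  | basic s hs =>
    obtain ⟨n, F, hF, rfl⟩ := hs
    exact ⟨n, F, hF, hx, subset_rfl⟩
  | univ => exact ⟨0, 1, isHomogeneous_one _ _, by simp [basicOpen], Set.subset_univ _⟩
  | inter s t _ _ hs ht =>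
    obtain ⟨m, F, hF, hxF, hFs⟩ := hs hx.1
    obtain ⟨n, G, hG, hxG, hGt⟩ := ht hx.2
    refine ⟨m + n, F * G, hF.mul hG, ?_, fun y hy => ?_⟩
    · simp only [basicOpen, Set.mem_ofPred_eq, map_mul] at *
      exact mul_ne_zero hxF hxG
    · simp only [basicOpen, Set.mem_ofPred_eq, map_mul] at hy
      exact ⟨hFs (left_ne_zero_of_mul hy), hGt (right_ne_zero_of_mul hy)⟩
  | sUnion S _ ih =>
    obtain ⟨s, hs, hxs⟩ := hx
    obtain ⟨n, F, hF, hxF, hFs⟩ := ih s hs hxs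
    exact ⟨n, F, hF, hxF, hFs.trans (Set.subset_sUnion_of_mem hs)⟩

/-- Nonempty open sets are dense: a polynomial that vanishes on the cone over the intersection
of two of them is zero. -/
theorem eq_zero_of_eval_eq_zero_on_cone [Infinite K] {U V : Opens (Plane K)} {x y : Plane K}
    (hx : x ∈ U) (hy : y ∈ V) {p : MvPolynomial (Fin 3) K}
    (h : ∀ v, v ∈ cone (U : Set (Plane K)) → v ∈ cone (V : Set (Plane K)) → eval v p = 0) :
    p = 0 := by
  obtain ⟨m, F, hF, hxF, hFU⟩ := exists_basicOpen_subset U.2 hx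
  obtain ⟨n, G, hG, hyG, hGV⟩ := exists_basicOpen_subset V.2 hy
  have hF0 : F ≠ 0 := by rintro rfl; simp [basicOpen] at hxF
  have hG0 : G ≠ 0 := by rintro rfl; simp [basicOpen] at hyG
  -- the factor `X 0` takes care of the origin
  have hz : p * (F * G * X 0) = 0 := by
    refine MvPolynomial.funext fun v => ?_
    rw [map_zero, map_mul, map_mul, map_mul, eval_X]
    by_contra hne
    have h1 := right_ne_zero_of_mul hne
    have hv : v ≠ 0 := by
      rintro rfl
      simp at h1
    refine left_ne_zero_of_mul hne (h v (cone_mono hFU ((mem_cone_basicOpen hF).mpr ⟨hv, ?_⟩))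
      (cone_mono hGV ((mem_cone_basicOpen hG).mpr ⟨hv, ?_⟩)))
    · exact left_ne_zero_of_mul (left_ne_zero_of_mul h1)
    · exact right_ne_zero_of_mul (left_ne_zero_of_mul h1)
  exact (mul_eq_zero.mp hz).resolve_right (mul_ne_zero (mul_ne_zero hF0 hG0) (X_ne_zero 0))

variable (K) in
/-- The standard affine chart on which the `i`-th coordinate does not vanish. -/
def chart (i : Fin 3) : Opens (Plane K) :=
  ⟨basicOpen (X i), isOpen_basicOpen (isHomogeneous_X K i)⟩

theorem mem_cone_chart {i : Fin 3} {v : Fin 3 → K} :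
    v ∈ cone (chart K i : Set (Plane K)) ↔ v i ≠ 0 := by
  refine (mem_cone_basicOpen (isHomogeneous_X K i)).trans ?_
  rw [eval_X]
  exact ⟨fun h => h.2, fun h => ⟨fun h0 => h (congrFun h0 i), h⟩⟩

theorem mem_cone_inf {U V : Opens (Plane K)} {v : Fin 3 → K} :
    v ∈ cone ((U ⊓ V : Opens (Plane K)) : Set (Plane K)) ↔
      v ∈ cone (U : Set (Plane K)) ∧ v ∈ cone (V : Set (Plane K)) :=
  ⟨fun h => ⟨⟨h.1, h.2.1⟩, ⟨h.1, h.2.2⟩⟩, fun h => ⟨h.1.1, h.1.2, h.2.2⟩⟩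

theorem ne_zero_of_mem_cone {U : Set (Plane K)} {v : Fin 3 → K} (h : v ∈ cone U) : v ≠ 0 := h.1

theorem exists_mem_cone_chart {v : Fin 3 → K} (hv : v ≠ 0) :
    ∃ i, v ∈ cone (chart K i : Set (Plane K)) := by
  obtain ⟨i, hi⟩ := Function.ne_iff.mp hv
  exact ⟨i, mem_cone_chart.mpr hi⟩

theorem exists_mem_chart (x : Plane K) : ∃ i, x ∈ chart K i := by
  obtain ⟨i, hi⟩ := Function.ne_iff.mp (Projectivization.rep_nonzero x)
  refine ⟨i, ?_⟩
  change eval x.rep (X i) ≠ 0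
  rwa [eval_X]

/-! ### Sections of the line bundles -/

theorem IsRegularSection.of_locally {d : ℤ} {U : Opens (Plane K)}
    {s : cone (U : Set (Plane K)) → K}
    (h : ∀ x ∈ U, ∃ (V : Opens (Plane K)) (t : cone (V : Set (Plane K)) → K), x ∈ V ∧
      IsRegularSection d V t ∧ ∀ v hU hV, s ⟨v, hU⟩ = t ⟨v, hV⟩) :
    IsRegularSection d U s := by
  intro x hx
  obtain ⟨V, t, hxV, ht, hst⟩ := h x hx
  obtain ⟨W, hxW, m, n, P, Q, hP, hQ, e, H⟩ := ht x hxV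
  refine ⟨V ⊓ W, ⟨hxV, hxW⟩, m, n, P, Q, hP, hQ, e, fun v hv => ?_⟩
  obtain ⟨hV, hW⟩ := mem_cone_inf.mp hv
  rw [hst v.1 v.2 hV]
  exact H ⟨v.1, hV⟩ hW

theorem IsRegularSection.congr_degree {d e : ℤ} {U : Opens (Plane K)}
    {s : cone (U : Set (Plane K)) → K} (hs : IsRegularSection d U s) (h : d = e) :
    IsRegularSection e U s := h ▸ hs

/-- A form of degree `d` is a section of `𝒪(d)`. -/
theorem isRegularSection_of_isForm {d : ℤ} {p : MvPolynomial (Fin 3) K} (hp : IsForm d p)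
    (U : Opens (Plane K)) : IsRegularSection d U fun v => eval v.1 p := by
  rcases eq_or_ne p 0 with rfl | h0
  · simp only [map_zero]
    exact IsRegularSection.zero d U
  obtain ⟨k, rfl, hk⟩ := hp.exists_nat h0
  exact fun x _ => ⟨⊤, trivial, k, 0, p, 1, hk, isHomogeneous_one _ _, by simp, by simp⟩

/-- The inverse of a form of degree `n` is a section of `𝒪(-n)` where the form does not
vanish. -/
theorem isRegularSection_inv {n : ℕ} {q : MvPolynomial (Fin 3) K} (hq : q.IsHomogeneous n)
    {U : Opens (Plane K)} (h : ∀ v ∈ cone (U : Set (Plane K)), eval v q ≠ 0) :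
    IsRegularSection (-n) U fun v => (eval v.1 q)⁻¹ := fun x _ =>
  ⟨⊤, trivial, 0, n, 1, q, isHomogeneous_one _ _, hq, by simp, fun v _ => ⟨h v.1 v.2, by simp⟩⟩

/-- The generator `Xᵢᵈ` of `𝒪(d)` on the `i`-th chart. -/
theorem isRegularSection_zpow (d : ℤ) (i : Fin 3) :
    IsRegularSection d (chart K i) fun v => v.1 i ^ d := by
  intro x _
  refine ⟨⊤, trivial, d.toNat, (-d).toNat, X i ^ d.toNat, X i ^ (-d).toNat,
    isHomogeneous_X_pow _ _, isHomogeneous_X_pow _ _, by omega, fun v _ => ?_⟩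
  have hv : v.1 i ≠ 0 := mem_cone_chart.mp v.2
  refine ⟨by simp [hv], ?_⟩
  simp only [map_pow, eval_X]
  rw [← zpow_natCast, ← zpow_natCast, ← zpow_sub₀ hv]
  congr 1
  omega

/-- A function on the punctured cone that is locally a quotient of forms whose degrees differ
by `d` is a form of degree `d`: a reduced local denominator divides every other one, so that it
has no nontrivial zero. -/
theorem exists_isForm_of_locally_quotient [IsAlgClosed K] {d : ℤ} (φ : (Fin 3 → K) → K)
    (h : ∀ x : Plane K, ∃ V : Opens (Plane K), x ∈ V ∧
      ∃ (m n : ℕ) (P Q : MvPolynomial (Fin 3) K), P.IsHomogeneous m ∧ Q.IsHomogeneous n ∧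
        (m : ℤ) = n + d ∧ ∀ v ∈ cone (V : Set (Plane K)),
          eval v Q ≠ 0 ∧ φ v = eval v P / eval v Q) :
    ∃ p, IsForm d p ∧ ∀ v, v ≠ 0 → φ v = eval v p := by
  have : Infinite K := IsAlgClosed.instInfinite
  have hv0 : (fun _ => 1 : Fin 3 → K) ≠ 0 := fun h0 => one_ne_zero (congrFun h0 0)
  let x₀ : Plane K := Projectivization.mk K _ hv0
  obtain ⟨V, hxV, m, n, P, Q, hP, hQ, e, H⟩ := h x₀
  have hQ0 : Q ≠ 0 := by
    rintro rfl
    exact (H _ ⟨hv0, hxV⟩).1 (map_zero _)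
  -- the quotient at one point, in lowest terms, represents `φ` at all the other points
  obtain ⟨P₁, Q₁, c, hrel, rfl, rfl⟩ :=
    UniqueFactorizationMonoid.exists_reduced_factors' P Q hQ0
  have hc0 : c ≠ 0 := left_ne_zero_of_mul hQ0
  have key : ∀ v : Fin 3 → K, v ≠ 0 → eval v Q₁ ≠ 0 ∧ φ v = eval v P₁ / eval v Q₁ := by
    intro v hv
    obtain ⟨V', hxV', m', n', P', Q', hP', hQ', e', H'⟩ := h (Projectivization.mk K v hv)
    have h1 : (c * P₁) * Q' - P' * (c * Q₁) = 0 := by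
      refine eq_zero_of_eval_eq_zero_on_cone hxV hxV' fun w hw hw' => ?_
      obtain ⟨h1, h2⟩ := H w hw
      obtain ⟨h3, h4⟩ := H' w hw'
      rw [h2, div_eq_div_iff h1 h3] at h4
      simp only [map_sub, map_mul] at h4 ⊢
      rw [h4, sub_self]
    have h2 : P₁ * Q' = P' * Q₁ := by
      refine mul_left_cancel₀ hc0 ?_
      linear_combination h1
    have h3 : Q₁ ∣ Q' := hrel.symm.dvd_of_dvd_mul_left (h2 ▸ dvd_mul_left _ _)
    obtain ⟨h4, h5⟩ := H' v ⟨hv, hxV'⟩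
    have h6 : eval v Q₁ ≠ 0 := by
      obtain ⟨r, rfl⟩ := h3
      rw [map_mul] at h4
      exact left_ne_zero_of_mul h4
    refine ⟨h6, ?_⟩
    rw [h5, div_eq_div_iff h4 h6, ← map_mul, ← map_mul, h2]
  obtain ⟨k, hk⟩ := exists_isHomogeneous_of_mul hQ hQ0
  obtain rfl := degree_eq_zero_of_forall_eval_ne_zero hk fun v hv => (key v hv).1
  have hC : Q₁ = C (coeff 0 Q₁) := IsForm.eq_C (by exact_mod_cast isForm_natCast.mpr hk)
  have hr : coeff 0 Q₁ ≠ 0 := fun h0 => right_ne_zero_of_mul hQ0 (by rw [hC, h0, C_0])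
  have hQc : IsForm (n : ℤ) c := by
    refine (IsForm.C (coeff 0 Q₁)).of_mul (by simpa using hr) ?_
    rw [← hC, mul_comm, zero_add]
    exact isForm_natCast.mpr hQ
  have hP1 : IsForm d P₁ := hQc.of_mul hc0 ((isForm_natCast.mpr hP).congr e)
  refine ⟨C (coeff 0 Q₁)⁻¹ * P₁, ((IsForm.C _).mul hP1).congr (zero_add d), fun v hv => ?_⟩
  rw [(key v hv).2]
  conv_lhs => rw [hC]
  simp [div_eq_inv_mul]

/-- A morphism of sheaves of modules from `𝒪(e)` to `𝒪(e')` is the multiplication by a form of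
degree `e' - e`. -/
theorem exists_isForm_of_morphism [IsAlgClosed K] {e e' : ℤ}
    (φ : ∀ U : Opens (Plane K), lineBundle e U → cone (U : Set (Plane K)) → K)
    (hreg : ∀ U s, IsRegularSection e' U (φ U s))
    (hsmul : ∀ U (r : regularFunctions U) s v, φ U (r • s) v = r.1 v * φ U s v)
    (hres : ∀ {U V : Opens (Plane K)} (h : V ≤ U) s,
      φ V (resLineBundle h s) = restrict h (φ U s)) :
    ∃ p, IsForm (e' - e) p ∧ ∀ U s v, φ U s v = s.1 v * eval v.1 p := by
  classical
  let gen (i : Fin 3) : lineBundle e (chart K i) :=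
    ⟨fun v => v.1 i ^ e, isRegularSection_zpow e i⟩
  have key : ∀ (U : Opens (Plane K)) s (v : cone (U : Set (Plane K))) i
      (hi : v.1 ∈ cone (chart K i : Set (Plane K))), φ U s v =
        s.1 v * (v.1 i ^ (-e) * φ (chart K i) (gen i) ⟨v.1, hi⟩) := by
    intro U s v i hi
    obtain ⟨W, hWU, hWi, hvW⟩ : ∃ W : Opens (Plane K), W ≤ U ∧ W ≤ chart K i ∧
        v.1 ∈ cone (W : Set (Plane K)) :=
      ⟨U ⊓ chart K i, inf_le_left, inf_le_right, mem_cone_inf.mpr ⟨v.2, hi⟩⟩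
    let r : regularFunctions W :=
      ⟨fun w => s.1 ⟨w.1, cone_mono hWU w.2⟩ * w.1 i ^ (-e),
        ((IsRegularSection.restrict hWU s.2).mul
          (IsRegularSection.restrict hWi (isRegularSection_zpow (-e) i))).congr_degree
          (add_neg_cancel e)⟩
    have h1 : resLineBundle hWU s = r • resLineBundle hWi (gen i) := by
      refine Subtype.ext (_root_.funext fun w => ?_)
      have hw : w.1 i ≠ 0 := mem_cone_chart.mp (cone_mono hWi w.2)
      change s.1 _ = (s.1 _ * w.1 i ^ (-e)) * w.1 i ^ e
      rw [mul_assoc, ← zpow_add₀ hw, neg_add_cancel, zpow_zero, mul_one]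
    have h2 := congrFun (hres hWU s) ⟨v.1, hvW⟩
    rw [h1, hsmul, hres] at h2
    rw [← mul_assoc]
    exact h2.symm
  -- the quotient `φ s / s`, computed with the generator of `𝒪(e)` on a chart
  let Φ : (Fin 3 → K) → K := fun v =>
    if h : ∃ i, v ∈ cone (chart K i : Set (Plane K)) then
      v h.choose ^ (-e) * φ (chart K h.choose) (gen h.choose) ⟨v, h.choose_spec⟩ else 0
  have hΦ : ∀ (U : Opens (Plane K)) s (v : cone (U : Set (Plane K))), φ U s v = s.1 v * Φ v.1 := by
    intro U s v
    have h := exists_mem_cone_chart (ne_zero_of_mem_cone v.2)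
    simp only [Φ]
    rw [dif_pos h]
    exact key U s v _ _
  obtain ⟨p, hp, hp'⟩ : ∃ p, IsForm (e' - e) p ∧ ∀ v, v ≠ 0 → Φ v = eval v p := by
    refine exists_isForm_of_locally_quotient Φ fun x => ?_
    obtain ⟨i, hi⟩ := exists_mem_chart x
    obtain ⟨V, hxV, m, n, P, Q, hP, hQ, hmn, H⟩ :=
      (isRegularSection_zpow (-e) i).mul (hreg (chart K i) (gen i)) x hi
    refine ⟨chart K i ⊓ V, ⟨hi, hxV⟩, m, n, P, Q, hP, hQ, by omega, fun v hv => ?_⟩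
    obtain ⟨h1, h2⟩ := mem_cone_inf.mp hv
    obtain ⟨h3, h4⟩ := H ⟨v, h1⟩ h2
    refine ⟨h3, h4 ▸ ?_⟩
    have hv : v i ≠ 0 := mem_cone_chart.mp h1
    rw [Pi.mul_apply, hΦ]
    change Φ v = v i ^ (-e) * (v i ^ e * Φ v)
    rw [← mul_assoc, ← zpow_add₀ hv, neg_add_cancel, zpow_zero, one_mul]
  exact ⟨p, hp, fun U s v => by rw [hΦ, hp' v.1 (ne_zero_of_mem_cone v.2)]⟩

/-! ### Splittings of the logarithmic bundle and homogeneous bases -/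

/-- The polynomial vector field `θ` annihilates `f`. -/
def Annihilates (θ : Fin 3 → MvPolynomial (Fin 3) K) (f : MvPolynomial (Fin 3) K) : Prop :=
  ∑ i, θ i * pderiv i f = 0

/-- The vector fields `σ` and `τ`, homogeneous of degrees `d₁` and `d₂`, generate the graded
module of the polynomial vector fields which annihilate `f`. -/
structure IsGeneratingPair (f : MvPolynomial (Fin 3) K) (d₁ d₂ : ℤ)
    (σ τ : Fin 3 → MvPolynomial (Fin 3) K) : Prop where
  isForm_left : ∀ k, IsForm d₁ (σ k)
  isForm_right : ∀ k, IsForm d₂ (τ k)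
  annihilates_left : Annihilates σ f
  annihilates_right : Annihilates τ f
  exists_eq : ∀ (n : ℤ) (θ : Fin 3 → MvPolynomial (Fin 3) K), (∀ k, IsForm n (θ k)) →
    Annihilates θ f → ∃ g h, IsForm (n - d₁) g ∧ IsForm (n - d₂) h ∧
      ∀ k, θ k = g * σ k + h * τ k

/-- The product of a section of `𝒪(-n)` and a homogeneous vector field of degree `n` which
annihilates `f`. -/
def fieldSection {f : MvPolynomial (Fin 3) K} {n : ℤ} {θ : Fin 3 → MvPolynomial (Fin 3) K}
    (hθ : ∀ k, IsForm n (θ k)) (hf : Annihilates θ f) (U : Opens (Plane K))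
    (s : lineBundle (-n) U) : logSheaf f U :=
  ⟨fun k => ⟨fun v => s.1 v * eval v.1 (θ k),
    ((IsRegularSection.mul s.2 (isRegularSection_of_isForm (hθ k) U))).congr_degree
      (neg_add_cancel n)⟩,
    LinearMap.mem_ker.mpr <| _root_.funext fun v => by
      have := congrArg (eval v.1) hf
      simp only [map_sum, map_mul, map_zero] at this
      change ∑ k, s.1 v * eval v.1 (θ k) * eval v.1 (pderiv k f) = 0
      simp only [mul_assoc, ← Finset.mul_sum, this, mul_zero]⟩

theorem eq_of_eval_eq_on_chart [Infinite K] {p q : MvPolynomial (Fin 3) K}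
    (h : ∀ v ∈ cone (chart K 0 : Set (Plane K)), eval v p = eval v q) : p = q := by
  have hv : (fun _ => 1 : Fin 3 → K) ∈ cone (chart K 0 : Set (Plane K)) :=
    mem_cone_chart.mpr one_ne_zero
  refine sub_eq_zero.mp (eq_zero_of_eval_eq_zero_on_cone hv.2 hv.2 fun v hv _ => ?_)
  rw [map_sub, h v hv, sub_self]

/-- A vector field whose multiples by sections lie in the kernel of the Jacobian map annihilates
`f`; the chart `X₀ ≠ 0` is enough, where `𝒪(-n)` has a section without zeros. -/
theorem annihilates_of_forall_section [Infinite K] {f : MvPolynomial (Fin 3) K} {n : ℤ}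
    {θ : Fin 3 → MvPolynomial (Fin 3) K}
    (h : ∀ s : lineBundle (-n) (chart K 0), ∃ η : logSheaf f (chart K 0),
      ∀ k v, (η.1 k).1 v = s.1 v * eval v.1 (θ k)) : Annihilates θ f := by
  obtain ⟨η, hη⟩ := h ⟨_, isRegularSection_zpow (-n) 0⟩
  refine eq_of_eval_eq_on_chart fun v hv => ?_
  have h1 := congrFun (LinearMap.mem_ker.mp η.2) ⟨v, hv⟩
  change ∑ k, (η.1 k).1 ⟨v, hv⟩ * eval v (pderiv k f) = 0 at h1
  simp only [hη, mul_assoc, ← Finset.mul_sum] at h1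
  have hv0 : v 0 ^ (-n) ≠ 0 := zpow_ne_zero _ (mem_cone_chart.mp hv)
  simpa using (mul_eq_zero.mp h1).resolve_left hv0

/-- The restriction of a splitting to the first summand is given by a homogeneous polynomial vector
field. -/
theorem Splitting.exists_left [IsAlgClosed K] {f : MvPolynomial (Fin 3) K} {d₁ d₂ : ℤ}
    (S : Splitting f d₁ d₂) : ∃ σ : Fin 3 → MvPolynomial (Fin 3) K, (∀ k, IsForm d₁ (σ k)) ∧
      ∀ (U : Opens (Plane K)) (s : lineBundle (-d₁) U) k v,
        ((S.equiv U (s, 0)).1 k).1 v = s.1 v * eval v.1 (σ k) := by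
  have hl : ∀ k, ∃ p, IsForm d₁ p ∧ ∀ (U : Opens (Plane K)) (s : lineBundle (-d₁) U) v,
      ((S.equiv U (s, 0)).1 k).1 v = s.1 v * eval v.1 p := by
    intro k
    obtain ⟨p, hp, H⟩ := exists_isForm_of_morphism (e := -d₁) (e' := 0)
      (fun U s => ((S.equiv U (s, 0)).1 k).1) (fun U s => ((S.equiv U (s, 0)).1 k).2)
      (fun U r s v => by
        have : ((r • s, 0) : lineBundle (-d₁) U × lineBundle (-d₂) U) = r • (s, 0) := by simp
        rw [this, map_smul]
        rfl)
      (fun {U V} h s => by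
        have := S.equiv_res h (s, 0)
        change S.equiv V (resLineBundle h s, 0) = _ at this
        simp only [this]
        rfl)
    exact ⟨p, hp.congr (by ring), H⟩
  choose σ hσ Hσ using hl
  exact ⟨σ, hσ, fun U s k v => Hσ k U s v⟩

/-- The restriction of a splitting to the second summand is given by a homogeneous polynomial vector
field. -/
theorem Splitting.exists_right [IsAlgClosed K] {f : MvPolynomial (Fin 3) K} {d₁ d₂ : ℤ}
    (S : Splitting f d₁ d₂) : ∃ τ : Fin 3 → MvPolynomial (Fin 3) K, (∀ k, IsForm d₂ (τ k)) ∧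
      ∀ (U : Opens (Plane K)) (s : lineBundle (-d₂) U) k v,
        ((S.equiv U (0, s)).1 k).1 v = s.1 v * eval v.1 (τ k) := by
  have hr : ∀ k, ∃ p, IsForm d₂ p ∧ ∀ (U : Opens (Plane K)) (s : lineBundle (-d₂) U) v,
      ((S.equiv U (0, s)).1 k).1 v = s.1 v * eval v.1 p := by
    intro k
    obtain ⟨p, hp, H⟩ := exists_isForm_of_morphism (e := -d₂) (e' := 0)
      (fun U s => ((S.equiv U (0, s)).1 k).1) (fun U s => ((S.equiv U (0, s)).1 k).2)
      (fun U r s v => by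
        have : ((0, r • s) : lineBundle (-d₁) U × lineBundle (-d₂) U) = r • (0, s) := by simp
        rw [this, map_smul]
        rfl)
      (fun {U V} h s => by
        have := S.equiv_res h (0, s)
        change S.equiv V (0, resLineBundle h s) = _ at this
        simp only [this]
        rfl)
    exact ⟨p, hp.congr (by ring), H⟩
  choose τ hτ Hτ using hr
  exact ⟨τ, hτ, fun U s k v => Hτ k U s v⟩

/-- The components with respect to a splitting of the morphism `𝒪(-n) → 𝒯` defined by a
homogeneous vector field `θ` are multiplications by forms, the coefficients of `θ`. -/
theorem Splitting.exists_coefficients [IsAlgClosed K] {f : MvPolynomial (Fin 3) K}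
    {d₁ d₂ n : ℤ} (S : Splitting f d₁ d₂) {θ : Fin 3 → MvPolynomial (Fin 3) K}
    (hθ : ∀ k, IsForm n (θ k)) (hf : Annihilates θ f) :
    ∃ g h, IsForm (n - d₁) g ∧ IsForm (n - d₂) h ∧
      ∀ (U : Opens (Plane K)) (s : lineBundle (-n) U), ∃ s₁ s₂,
        fieldSection hθ hf U s = S.equiv U (s₁, 0) + S.equiv U (0, s₂) ∧
        (∀ v, s₁.1 v = s.1 v * eval v.1 g) ∧ ∀ v, s₂.1 v = s.1 v * eval v.1 h := by
  have hfs : ∀ (U : Opens (Plane K)) (r : regularFunctions U) (s : lineBundle (-n) U),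
      fieldSection hθ hf U (r • s) = r • fieldSection hθ hf U s := by
    intro U r s
    refine Subtype.ext (_root_.funext fun k => Subtype.ext (_root_.funext fun v => ?_))
    exact mul_assoc (r.1 v) (s.1 v) _
  have hres : ∀ {U V : Opens (Plane K)} (h : V ≤ U) (s : lineBundle (-n) U),
      (S.equiv V).symm (fieldSection hθ hf V (resLineBundle h s)) =
        (resLineBundle h ((S.equiv U).symm (fieldSection hθ hf U s)).1,
          resLineBundle h ((S.equiv U).symm (fieldSection hθ hf U s)).2) := by
    intro U V h s
    rw [LinearEquiv.symm_apply_eq, S.equiv_res, LinearEquiv.apply_symm_apply]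
    rfl
  obtain ⟨g, hg, Hg⟩ := exists_isForm_of_morphism (e := -n) (e' := -d₁)
    (fun U s => ((S.equiv U).symm (fieldSection hθ hf U s)).1.1)
    (fun U s => ((S.equiv U).symm (fieldSection hθ hf U s)).1.2)
    (fun U r s v => by rw [hfs, map_smul]; rfl)
    (fun {U V} h s => by rw [hres]; rfl)
  obtain ⟨h, hh, Hh⟩ := exists_isForm_of_morphism (e := -n) (e' := -d₂)
    (fun U s => ((S.equiv U).symm (fieldSection hθ hf U s)).2.1)
    (fun U s => ((S.equiv U).symm (fieldSection hθ hf U s)).2.2)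
    (fun U r s v => by rw [hfs, map_smul]; rfl)
    (fun {U V} h s => by rw [hres]; rfl)
  refine ⟨g, h, hg.congr (by ring), hh.congr (by ring), fun U s =>
    ⟨_, _, ?_, Hg U s, Hh U s⟩⟩
  rw [← map_add, Prod.mk_add_mk, add_zero, zero_add, Prod.mk.eta, LinearEquiv.apply_symm_apply]

/-- A splitting of the logarithmic bundle comes from two homogeneous generators of the module
of vector fields annihilating `f`. -/
theorem Splitting.exists_isGeneratingPair [IsAlgClosed K] {f : MvPolynomial (Fin 3) K}
    {d₁ d₂ : ℤ} (S : Splitting f d₁ d₂) : ∃ σ τ, IsGeneratingPair f d₁ d₂ σ τ := by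
  have : Infinite K := IsAlgClosed.instInfinite
  obtain ⟨σ, hσ, Hσ⟩ := S.exists_left
  obtain ⟨τ, hτ, Hτ⟩ := S.exists_right
  refine ⟨σ, τ, hσ, hτ, annihilates_of_forall_section (n := d₁) fun s => ⟨_, Hσ _ s⟩,
    annihilates_of_forall_section (n := d₂) fun s => ⟨_, Hτ _ s⟩, fun n θ hθ hf => ?_⟩
  obtain ⟨g, h, hg, hh, H⟩ := S.exists_coefficients hθ hf
  refine ⟨g, h, hg, hh, fun k => eq_of_eval_eq_on_chart fun v hv => ?_⟩
  obtain ⟨s₁, s₂, h0, h1, h2⟩ := H (chart K 0) ⟨_, isRegularSection_zpow (-n) 0⟩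
  have hv0 : v 0 ^ (-n) ≠ 0 := zpow_ne_zero _ (mem_cone_chart.mp hv)
  have h3 : v 0 ^ (-n) * eval v (θ k) = ((S.equiv _ (s₁, 0)).1 k).1 ⟨v, hv⟩ +
      ((S.equiv _ (0, s₂)).1 k).1 ⟨v, hv⟩ :=
    congrArg (fun η : logSheaf f (chart K 0) => (η.1 k).1 ⟨v, hv⟩) h0
  rw [Hσ, Hτ, h1, h2] at h3
  rw [map_add, map_mul, map_mul]
  refine mul_left_cancel₀ hv0 (h3.trans ?_)
  ring

/-- The morphism `(s, t) ↦ s σ + t τ` on sections over `U`. -/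
def IsGeneratingPair.sectionMap {f : MvPolynomial (Fin 3) K} {d₁ d₂ : ℤ}
    {σ τ : Fin 3 → MvPolynomial (Fin 3) K} (h : IsGeneratingPair f d₁ d₂ σ τ)
    (U : Opens (Plane K)) :
    (lineBundle (-d₁) U × lineBundle (-d₂) U) →ₗ[regularFunctions U] logSheaf f U where
  toFun s := fieldSection h.isForm_left h.annihilates_left U s.1 +
    fieldSection h.isForm_right h.annihilates_right U s.2
  map_add' s t := by
    refine Subtype.ext (_root_.funext fun k => Subtype.ext (_root_.funext fun v => ?_))
    change (s.1.1 v + t.1.1 v) * _ + (s.2.1 v + t.2.1 v) * _ =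
      (s.1.1 v * _ + s.2.1 v * _) + (t.1.1 v * _ + t.2.1 v * _)
    ring
  map_smul' r s := by
    refine Subtype.ext (_root_.funext fun k => Subtype.ext (_root_.funext fun v => ?_))
    change (r.1 v * s.1.1 v) * _ + (r.1 v * s.2.1 v) * _ =
      r.1 v * (s.1.1 v * _ + s.2.1 v * _)
    ring

theorem IsGeneratingPair.sectionMap_apply {f : MvPolynomial (Fin 3) K} {d₁ d₂ : ℤ}
    {σ τ : Fin 3 → MvPolynomial (Fin 3) K} (h : IsGeneratingPair f d₁ d₂ σ τ)
    (U : Opens (Plane K)) (s : lineBundle (-d₁) U × lineBundle (-d₂) U) (k : Fin 3)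
    (v : cone (U : Set (Plane K))) :
    ((h.sectionMap U s).1 k).1 v = s.1.1 v * eval v.1 (σ k) + s.2.1 v * eval v.1 (τ k) := rfl

theorem IsGeneratingPair.sectionMap_injective [Infinite K] {f : MvPolynomial (Fin 3) K}
    {d₁ d₂ : ℤ} {σ τ : Fin 3 → MvPolynomial (Fin 3) K} (h : IsGeneratingPair f d₁ d₂ σ τ)
    (hli : ∀ g g', (∀ k, g * σ k + g' * τ k = 0) → g = 0 ∧ g' = 0) (U : Opens (Plane K)) :
    Function.Injective (h.sectionMap U) := by
  rw [injective_iff_map_eq_zero]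
  rintro s hs
  have key : ∀ v : cone (U : Set (Plane K)), s.1.1 v = 0 ∧ s.2.1 v = 0 := by
    intro v
    obtain ⟨V, hxV, m, n, P, Q, hP, hQ, e, H⟩ := s.1.2 _ v.2.2
    obtain ⟨V', hxV', m', n', P', Q', hP', hQ', e', H'⟩ := s.2.2 _ v.2.2
    have h0 := hli (P * Q') (P' * Q) fun k => by
      refine eq_zero_of_eval_eq_zero_on_cone (U := U ⊓ V) (V := V') ⟨v.2.2, hxV⟩ hxV'
        fun w hw hwV' => ?_
      obtain ⟨hwU, hwV⟩ := mem_cone_inf.mp hw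
      obtain ⟨h1, h2⟩ := H ⟨w, hwU⟩ hwV
      obtain ⟨h3, h4⟩ := H' ⟨w, hwU⟩ hwV'
      have h5 : s.1.1 ⟨w, hwU⟩ * eval w (σ k) + s.2.1 ⟨w, hwU⟩ * eval w (τ k) = 0 := by
        rw [← h.sectionMap_apply U s k ⟨w, hwU⟩, hs]
        rfl
      rw [h2, h4] at h5
      dsimp only at h1 h3 h5
      field_simp at h5
      simp only [map_add, map_mul]
      linear_combination h5
    obtain ⟨h1, h2⟩ := H v ⟨v.2.1, hxV⟩
    obtain ⟨h3, h4⟩ := H' v ⟨v.2.1, hxV'⟩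
    have h5 := congrArg (eval v.1) h0.1
    have h6 := congrArg (eval v.1) h0.2
    simp only [map_mul, map_zero] at h5 h6
    rw [h2, h4, (mul_eq_zero.mp h5).resolve_right h3, (mul_eq_zero.mp h6).resolve_right h1]
    simp
  exact Prod.ext (Subtype.ext (_root_.funext fun v => (key v).1))
    (Subtype.ext (_root_.funext fun v => (key v).2))

/-- Locally, a section of the kernel of the Jacobian map is the quotient of a polynomial vector
field which annihilates `f` by a form, hence a combination of the generators. -/
theorem IsGeneratingPair.exists_local [Infinite K] {f : MvPolynomial (Fin 3) K}
    {d₁ d₂ : ℤ} {σ τ : Fin 3 → MvPolynomial (Fin 3) K} (h : IsGeneratingPair f d₁ d₂ σ τ)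
    {U : Opens (Plane K)} (θ : logSheaf f U) {x : Plane K} (hx : x ∈ U) :
    ∃ (V : Opens (Plane K)) (n : ℕ) (g g' Q : MvPolynomial (Fin 3) K), x ∈ V ∧ V ≤ U ∧
      Q.IsHomogeneous n ∧ IsForm (n - d₁) g ∧ IsForm (n - d₂) g' ∧
      ∀ v (hU : v ∈ cone (U : Set (Plane K))), v ∈ cone (V : Set (Plane K)) → eval v Q ≠ 0 ∧
        ∀ k, (θ.1 k).1 ⟨v, hU⟩ * eval v Q = eval v (g * σ k + g' * τ k) := by
  have hloc : ∀ k, ∃ V : Opens (Plane K), x ∈ V ∧ ∃ (n : ℕ) (P Q : MvPolynomial (Fin 3) K),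
      P.IsHomogeneous n ∧ Q.IsHomogeneous n ∧ ∀ v : cone (U : Set (Plane K)),
        v.1 ∈ cone (V : Set (Plane K)) →
          eval v.1 Q ≠ 0 ∧ (θ.1 k).1 v = eval v.1 P / eval v.1 Q := by
    intro k
    obtain ⟨V, hxV, m, n, P, Q, hP, hQ, e, H⟩ := (θ.1 k).2 x hx
    obtain rfl : m = n := by omega
    exact ⟨V, hxV, m, P, Q, hP, hQ, H⟩
  choose V hxV n P Q hP hQ H using hloc
  let R : Fin 3 → MvPolynomial (Fin 3) K := fun k => P k * ∏ j ∈ Finset.univ.erase k, Q j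
  have hQR : (∏ j, Q j).IsHomogeneous (∑ j, n j) := IsHomogeneous.prod _ _ _ fun j _ => hQ j
  have hR : ∀ k, (R k).IsHomogeneous (∑ j, n j) := by
    intro k
    rw [← Finset.add_sum_erase _ _ (Finset.mem_univ k)]
    exact (hP k).mul (IsHomogeneous.prod _ _ _ fun j _ => hQ j)
  let W : Opens (Plane K) := U ⊓ (V 0 ⊓ (V 1 ⊓ V 2))
  have hxW : x ∈ W := ⟨hx, hxV 0, hxV 1, hxV 2⟩
  have hWV : ∀ k, W ≤ V k := by
    intro k y hy
    fin_cases k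
    exacts [hy.2.1, hy.2.2.1, hy.2.2.2]
  have key : ∀ v (hU : v ∈ cone (U : Set (Plane K))), v ∈ cone (W : Set (Plane K)) →
      eval v (∏ j, Q j) ≠ 0 ∧ ∀ k, (θ.1 k).1 ⟨v, hU⟩ * eval v (∏ j, Q j) = eval v (R k) := by
    intro v hU hW
    have hV : ∀ k, v ∈ cone (V k : Set (Plane K)) := fun k => cone_mono (hWV k) hW
    refine ⟨?_, fun k => ?_⟩
    · rw [map_prod]
      exact Finset.prod_ne_zero_iff.mpr fun j _ => (H j ⟨v, hU⟩ (hV j)).1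
    · obtain ⟨h1, h2⟩ := H k ⟨v, hU⟩ (hV k)
      rw [h2, ← Finset.mul_prod_erase _ _ (Finset.mem_univ k)]
      simp only [R, map_mul]
      rw [← mul_assoc, div_mul_cancel₀ _ h1]
  have hann : Annihilates R f := by
    refine eq_zero_of_eval_eq_zero_on_cone hxW hxW fun v hW _ => ?_
    have hU : v ∈ cone (U : Set (Plane K)) := cone_mono (fun y hy => hy.1) hW
    have h1 := congrFun (LinearMap.mem_ker.mp θ.2) ⟨v, hU⟩
    change ∑ k, (θ.1 k).1 ⟨v, hU⟩ * eval v (pderiv k f) = 0 at h1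
    rw [map_sum]
    calc ∑ k, eval v (R k * pderiv k f)
        = (∑ k, (θ.1 k).1 ⟨v, hU⟩ * eval v (pderiv k f)) * eval v (∏ j, Q j) := by
          rw [Finset.sum_mul]
          refine Finset.sum_congr rfl fun k _ => ?_
          rw [map_mul, ← (key v hU hW).2 k]
          ring
      _ = 0 := by rw [h1, zero_mul]
  obtain ⟨g, g', hg, hg', hR'⟩ :=
    h.exists_eq _ R (fun k => isForm_natCast.mpr (hR k)) hann
  refine ⟨W, ∑ j, n j, g, g', ∏ j, Q j, hxW, inf_le_left, hQR, hg, hg', fun v hU hW => ?_⟩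
  refine ⟨(key v hU hW).1, fun k => ?_⟩
  rw [(key v hU hW).2 k, hR']

theorem IsGeneratingPair.sectionMap_surjective [Infinite K] {f : MvPolynomial (Fin 3) K}
    {d₁ d₂ : ℤ} {σ τ : Fin 3 → MvPolynomial (Fin 3) K} (h : IsGeneratingPair f d₁ d₂ σ τ)
    (hli : ∀ g g', (∀ k, g * σ k + g' * τ k = 0) → g = 0 ∧ g' = 0) (U : Opens (Plane K)) :
    Function.Surjective (h.sectionMap U) := by
  intro θ
  have hloc := fun x : (U : Set (Plane K)) => h.exists_local θ x.2
  choose V n g g' Q hxV hVU hQ hg hg' H using hloc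
  -- the local coefficients agree on overlaps since the generators are independent
  have key : ∀ (x y : (U : Set (Plane K))) v, v ∈ cone (V x : Set (Plane K)) →
      v ∈ cone (V y : Set (Plane K)) →
      eval v (g x) * eval v (Q y) = eval v (g y) * eval v (Q x) ∧
      eval v (g' x) * eval v (Q y) = eval v (g' y) * eval v (Q x) := by
    intro x y v _ _
    have h0 := hli (g x * Q y - g y * Q x) (g' x * Q y - g' y * Q x) fun k => by
      refine eq_zero_of_eval_eq_zero_on_cone (hxV x) (hxV y) fun w hwx hwy => ?_
      obtain ⟨-, h2⟩ := H x w (cone_mono (hVU x) hwx) hwx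
      obtain ⟨-, h4⟩ := H y w (cone_mono (hVU x) hwx) hwy
      have h5 := h2 k
      have h6 := h4 k
      simp only [map_add, map_mul, map_sub] at h5 h6 ⊢
      linear_combination -eval w (Q y) * h5 + eval w (Q x) * h6
    have h1 := congrArg (eval v) h0.1
    have h2 := congrArg (eval v) h0.2
    simp only [map_sub, map_mul, map_zero] at h1 h2
    exact ⟨sub_eq_zero.mp h1, sub_eq_zero.mp h2⟩
  let pt : cone (U : Set (Plane K)) → ↥(U : Set (Plane K)) := fun v => ⟨_, v.2.2⟩
  have hpt : ∀ v, v.1 ∈ cone (V (pt v) : Set (Plane K)) := fun v => ⟨v.2.1, hxV (pt v)⟩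
  have hreg : ∀ (d : ℤ) (p : ↥(U : Set (Plane K)) → MvPolynomial (Fin 3) K),
      (∀ x, IsForm (n x - d) (p x)) →
      (∀ x y v, v ∈ cone (V x : Set (Plane K)) → v ∈ cone (V y : Set (Plane K)) →
        eval v (p x) * eval v (Q y) = eval v (p y) * eval v (Q x)) →
      IsRegularSection (-d) U
        fun v => eval v.1 (p (pt v)) * (eval v.1 (Q (pt v)))⁻¹ := by
    intro d p hp hpQ
    refine IsRegularSection.of_locally fun x hx => ⟨V ⟨x, hx⟩, _, hxV ⟨x, hx⟩,
      ((isRegularSection_of_isForm (hp ⟨x, hx⟩) _).mul (isRegularSection_inv (hQ ⟨x, hx⟩)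
        fun v hv => (H ⟨x, hx⟩ v (cone_mono (hVU _) hv) hv).1)).congr_degree (by ring),
      fun v hU hV => ?_⟩
    have h1 := (H (pt ⟨v, hU⟩) v hU (hpt ⟨v, hU⟩)).1
    have h2 := (H ⟨x, hx⟩ v hU hV).1
    rw [Pi.mul_apply, ← div_eq_mul_inv, ← div_eq_mul_inv, div_eq_div_iff h1 h2]
    exact hpQ _ _ v (hpt ⟨v, hU⟩) hV
  refine ⟨(⟨_, hreg d₁ g hg fun x y v hx hy => (key x y v hx hy).1⟩,
    ⟨_, hreg d₂ g' hg' fun x y v hx hy => (key x y v hx hy).2⟩), ?_⟩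
  refine Subtype.ext (_root_.funext fun k => Subtype.ext (_root_.funext fun v => ?_))
  obtain ⟨h1, h2⟩ := H (pt v) v.1 v.2 (hpt v)
  have h3 := h2 k
  rw [h.sectionMap_apply]
  simp only [map_add, map_mul] at h3 ⊢
  refine mul_right_cancel₀ h1 (Eq.trans ?_ h3.symm)
  field_simp

/-- A homogeneous basis of the module of vector fields annihilating `f` splits the logarithmic
bundle. -/
theorem IsGeneratingPair.nonempty_splitting [Infinite K] {f : MvPolynomial (Fin 3) K}
    {d₁ d₂ : ℤ} {σ τ : Fin 3 → MvPolynomial (Fin 3) K} (h : IsGeneratingPair f d₁ d₂ σ τ)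
    (hli : ∀ g g', (∀ k, g * σ k + g' * τ k = 0) → g = 0 ∧ g' = 0) :
    Nonempty (Splitting f d₁ d₂) :=
  ⟨{ equiv := fun U => LinearEquiv.ofBijective (h.sectionMap U)
        ⟨h.sectionMap_injective hli U, h.sectionMap_surjective hli U⟩
     equiv_res := fun _ _ => rfl }⟩

/-! ### Linear forms and vector fields -/

/-- The linear form with coefficients `w`. -/
def linForm (w : Fin 3 → K) : MvPolynomial (Fin 3) K := ∑ i, C (w i) * X i

theorem Line.equation_eq (l : Line K) : l.equation = linForm l.rep := rfl

theorem isForm_linForm (w : Fin 3 → K) : IsForm 1 (linForm w) :=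
  IsForm.sum _ fun i _ => ((IsForm.C _).mul (n := 1) (by
    exact_mod_cast isForm_natCast.mpr (isHomogeneous_X K i))).congr (by norm_num)

theorem linForm_combination (r s : K) (v w : Fin 3 → K) :
    linForm (r • v + s • w) = C r * linForm v + C s * linForm w := by
  simp only [linForm, Finset.mul_sum, ← Finset.sum_add_distrib, Pi.add_apply, Pi.smul_apply,
    smul_eq_mul, C_add, C_mul]
  exact Finset.sum_congr rfl fun i _ => by ring

theorem coeff_linForm (w : Fin 3 → K) (i : Fin 3) :
    coeff (Finsupp.single i 1) (linForm w) = w i := by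
  simp [linForm, coeff_sum, coeff_C_mul, coeff_X, Finsupp.single_left_inj]

theorem eval_linForm (w v : Fin 3 → K) : eval v (linForm w) = w ⬝ᵥ v := by
  simp [linForm, dotProduct]

theorem linForm_ne_zero {w : Fin 3 → K} (hw : w ≠ 0) : linForm w ≠ 0 := by
  obtain ⟨i, hi⟩ := Function.ne_iff.mp hw
  intro h
  apply hi
  rw [← coeff_linForm w, h, coeff_zero, Pi.zero_apply]

theorem prime_linForm {w : Fin 3 → K} (hw : w ≠ 0) : Prime (linForm w) := by
  refine Irreducible.prime (irreducible_of_totalDegree_eq_one ?_ fun x hx => ?_)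
  · have h : (linForm w).IsHomogeneous 1 :=
      isForm_natCast.mp (by exact_mod_cast isForm_linForm w)
    exact h.totalDegree (linForm_ne_zero hw)
  · obtain ⟨i, hi⟩ := Function.ne_iff.mp hw
    have := hx (Finsupp.single i 1)
    rw [coeff_linForm] at this
    exact isUnit_of_dvd_unit this (isUnit_iff_ne_zero.mpr hi)

theorem exists_smul_of_linForm_dvd {v w : Fin 3 → K} (hv : v ≠ 0) (h : linForm v ∣ linForm w) :
    ∃ r : K, w = r • v := by
  obtain ⟨q, hq⟩ := h
  have h0 : IsForm 0 q := (isForm_linForm v).of_mul (linForm_ne_zero hv) (by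
    rw [← hq, add_zero]; exact isForm_linForm w)
  refine ⟨coeff 0 q, _root_.funext fun i => ?_⟩
  rw [← coeff_linForm w, hq, h0.eq_C, mul_comm, coeff_C_mul, coeff_linForm, ← h0.eq_C]
  rfl

theorem Line.prime_equation (l : Line K) : Prime l.equation :=
  prime_linForm l.rep_nonzero

theorem Line.isForm_equation (l : Line K) : IsForm 1 l.equation := isForm_linForm _

theorem Line.not_equation_dvd {l m : Line K} (h : l ≠ m) : ¬ l.equation ∣ m.equation := by
  intro hd
  obtain ⟨r, hr⟩ := exists_smul_of_linForm_dvd l.rep_nonzero hd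
  apply h
  rw [← l.mk_rep, ← m.mk_rep, Projectivization.mk_eq_mk_iff']
  have hr0 : r ≠ 0 := by
    rintro rfl
    exact m.rep_nonzero (by rw [hr, zero_smul])
  exact ⟨r⁻¹, by rw [hr, smul_smul, inv_mul_cancel₀ hr0, one_smul]⟩

theorem Line.isRelPrime_equation {l m : Line K} (h : l ≠ m) :
    IsRelPrime l.equation m.equation :=
  (l.prime_equation.irreducible.isRelPrime_iff_not_dvd).mpr (Line.not_equation_dvd h)

theorem isHomogeneous_prod_equation (s : Finset (Line K)) :
    (∏ l ∈ s, l.equation).IsHomogeneous s.card := by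
  rw [Finset.card_eq_sum_ones]
  exact IsHomogeneous.prod _ _ _ fun l _ =>
    isForm_natCast.mp (by exact_mod_cast l.isForm_equation)

theorem prod_equation_ne_zero (s : Finset (Line K)) : ∏ l ∈ s, l.equation ≠ 0 :=
  Finset.prod_ne_zero_iff.mpr fun l _ => l.prime_equation.ne_zero

theorem isRelPrime_prod_equation {s t : Finset (Line K)} (h : ∀ l ∈ s, l ∉ t) :
    IsRelPrime (∏ l ∈ s, l.equation) (∏ l ∈ t, l.equation) :=
  IsRelPrime.prod_left fun l hl => IsRelPrime.prod_right fun _ hm =>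
    Line.isRelPrime_equation fun e => h l hl (e ▸ hm)

theorem prod_equation_dvd {s : Finset (Line K)} {p : MvPolynomial (Fin 3) K}
    (h : ∀ l ∈ s, l.equation ∣ p) : ∏ l ∈ s, l.equation ∣ p :=
  Finset.prod_dvd_of_isRelPrime (fun _ _ _ _ hlm => Line.isRelPrime_equation hlm) h

/-- The derivation given by a polynomial vector field. -/
def lie (θ : Fin 3 → MvPolynomial (Fin 3) K) :
    Derivation K (MvPolynomial (Fin 3) K) (MvPolynomial (Fin 3) K) :=
  mkDerivation K θ

theorem lie_apply (θ : Fin 3 → MvPolynomial (Fin 3) K) (p : MvPolynomial (Fin 3) K) :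
    lie θ p = ∑ i, θ i * pderiv i p := by
  induction p using MvPolynomial.induction_on with
  | C a => simp [lie]
  | add p q hp hq => simp [hp, hq, mul_add, Finset.sum_add_distrib]
  | mul_X p j hp =>
    rw [Derivation.leibniz, hp]
    simp [lie, pderiv_X, Finset.mul_sum, mul_add, Finset.sum_add_distrib, Pi.single_apply]
    congr 1
    · ring
    · exact Finset.sum_congr rfl fun i _ => by ring

theorem annihilates_iff {θ : Fin 3 → MvPolynomial (Fin 3) K} {f : MvPolynomial (Fin 3) K} :
    Annihilates θ f ↔ lie θ f = 0 := by
  rw [lie_apply, Annihilates]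

theorem lie_C_mul (θ : Fin 3 → MvPolynomial (Fin 3) K) (a : K) (p : MvPolynomial (Fin 3) K) :
    lie θ (C a * p) = C a * lie θ p := by
  rw [← smul_eq_C_mul, ← smul_eq_C_mul, Derivation.map_smul]

theorem lie_linForm (θ : Fin 3 → MvPolynomial (Fin 3) K) (w : Fin 3 → K) :
    lie θ (linForm w) = ∑ i, C (w i) * θ i := by
  simp only [linForm, map_sum]
  refine Finset.sum_congr rfl fun i _ => ?_
  rw [lie_C_mul, lie, mkDerivation_X]

theorem lie_combination (θ η : Fin 3 → MvPolynomial (Fin 3) K) (g h p : MvPolynomial (Fin 3) K) :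
    lie (fun k => g * θ k + h * η k) p = g * lie θ p + h * lie η p := by
  simp only [lie_apply, Finset.mul_sum, ← Finset.sum_add_distrib]
  exact Finset.sum_congr rfl fun i _ => by ring

/-- Euler's identity. -/
theorem lie_X {n : ℕ} {p : MvPolynomial (Fin 3) K} (hp : p.IsHomogeneous n)
    (h : MvPolynomial (Fin 3) K) : lie (fun k => h * X k) p = h * (C (n : K) * p) := by
  rw [lie_apply]
  simp only [mul_assoc, ← Finset.mul_sum]
  rw [hp.sum_X_mul_pderiv, nsmul_eq_mul, map_natCast]

theorem isForm_lie {n : ℤ} {m : ℕ} {θ : Fin 3 → MvPolynomial (Fin 3) K}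
    (hθ : ∀ k, IsForm n (θ k)) {p : MvPolynomial (Fin 3) K} (hp : p.IsHomogeneous m)
    (hm : m ≠ 0) : IsForm (m + (n - 1)) (lie θ p) := by
  rw [lie_apply]
  exact IsForm.sum _ fun i _ =>
    ((hθ i).mul (isForm_natCast.mpr (hp.pderiv (i := i)))).congr (by omega)

/-- A vector field that annihilates the equation of an arrangement is tangent to each of its
lines. -/
theorem equation_dvd_lie {𝒜 : Finset (Line K)} {θ : Fin 3 → MvPolynomial (Fin 3) K}
    (h : Annihilates θ (arrangementEquation 𝒜)) {l : Line K} (hl : l ∈ 𝒜) :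
    l.equation ∣ lie θ l.equation := by
  classical
  rw [annihilates_iff, arrangementEquation, ← Finset.mul_prod_erase _ _ hl,
    Derivation.leibniz, smul_eq_mul, smul_eq_mul] at h
  have h1 : l.equation ∣ (∏ m ∈ 𝒜.erase l, m.equation) * lie θ l.equation :=
    (dvd_add_right (dvd_mul_right _ _)).mp (h ▸ dvd_zero _)
  refine (l.prime_equation.dvd_or_dvd h1).resolve_left fun h2 => ?_
  obtain ⟨m, hm, hlm⟩ := l.prime_equation.exists_mem_finset_dvd h2
  exact Line.not_equation_dvd (Finset.ne_of_mem_erase hm).symm hlm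

/-- A vector field that is tangent to the lines of an arrangement preserves its equation up to a
factor. -/
theorem equation_dvd_lie_arrangementEquation {𝒜 : Finset (Line K)}
    {θ : Fin 3 → MvPolynomial (Fin 3) K} (h : ∀ l ∈ 𝒜, l.equation ∣ lie θ l.equation) :
    arrangementEquation 𝒜 ∣ lie θ (arrangementEquation 𝒜) := by
  classical
  unfold arrangementEquation
  induction 𝒜 using Finset.induction_on with
  | empty => simp
  | insert l s hl ih =>
    rw [Finset.prod_insert hl, Derivation.leibniz, smul_eq_mul, smul_eq_mul]
    refine dvd_add (mul_dvd_mul_left _ (ih fun m hm => h m (Finset.mem_insert_of_mem hm))) ?_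
    rw [mul_comm]
    exact mul_dvd_mul_left _ (h l (Finset.mem_insert_self _ _))

/-! ### Triangular arrangements and syzygies -/

/-- The data of a complete triangular arrangement: the sides `x`, `y`, `z` of the triangle, and
the families `fA`, `fB`, `fC` of the other lines through the vertices `y = z = 0`, `z = x = 0`
and `x = y = 0`. -/
structure TriangleData (K : Type*) [Field K] where
  /-- The side opposite to the first vertex. -/
  x : Line K
  /-- The side opposite to the second vertex. -/
  y : Line K
  /-- The side opposite to the third vertex. -/
  z : Line K
  linearIndependent : LinearIndependent K ![x.rep, y.rep, z.rep]
  /-- The inner lines through the first vertex. -/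
  fA : Finset (Line K)
  /-- The inner lines through the second vertex. -/
  fB : Finset (Line K)
  /-- The inner lines through the third vertex. -/
  fC : Finset (Line K)
  rep_fA : ∀ l ∈ fA, ∃ r s : K, r ≠ 0 ∧ s ≠ 0 ∧ l.rep = r • y.rep + s • z.rep
  rep_fB : ∀ l ∈ fB, ∃ r s : K, r ≠ 0 ∧ s ≠ 0 ∧ l.rep = r • z.rep + s • x.rep
  rep_fC : ∀ l ∈ fC, ∃ r s : K, r ≠ 0 ∧ s ≠ 0 ∧ l.rep = r • x.rep + s • y.rep

namespace TriangleData

variable (T : TriangleData K)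

theorem eq_zero_of_combination {r s t : K} (h : r • T.x.rep + s • T.y.rep + t • T.z.rep = 0) :
    r = 0 ∧ s = 0 ∧ t = 0 := by
  have := Fintype.linearIndependent_iff.mp T.linearIndependent ![r, s, t]
    (by simpa [Fin.sum_univ_three] using h)
  exact ⟨this 0, this 1, this 2⟩

/-- The cyclic permutation of the three vertices. -/
def rotate : TriangleData K where
  x := T.y
  y := T.z
  z := T.x
  linearIndependent := by
    refine Fintype.linearIndependent_iff.mpr fun g hg => ?_
    have h := T.eq_zero_of_combination (r := g 2) (s := g 0) (t := g 1) (by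
      rw [← hg]
      simp [Fin.sum_univ_three]
      abel)
    intro i
    fin_cases i
    exacts [h.2.1, h.2.2, h.1]
  fA := T.fB
  fB := T.fC
  fC := T.fA
  rep_fA := T.rep_fB
  rep_fB := T.rep_fC
  rep_fC := T.rep_fA

/-- The product of the equations of the inner lines through the first vertex. -/
def F : MvPolynomial (Fin 3) K := ∏ l ∈ T.fA, l.equation

/-- The product of the equations of the inner lines through the second vertex. -/
def G : MvPolynomial (Fin 3) K := ∏ l ∈ T.fB, l.equation

/-- The product of the equations of the inner lines through the third vertex. -/
def H : MvPolynomial (Fin 3) K := ∏ l ∈ T.fC, l.equation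

theorem isForm_F : IsForm T.fA.card T.F := isForm_natCast.mpr (isHomogeneous_prod_equation _)
theorem isForm_G : IsForm T.fB.card T.G := isForm_natCast.mpr (isHomogeneous_prod_equation _)
theorem isForm_H : IsForm T.fC.card T.H := isForm_natCast.mpr (isHomogeneous_prod_equation _)
theorem F_ne_zero : T.F ≠ 0 := prod_equation_ne_zero _
theorem G_ne_zero : T.G ≠ 0 := prod_equation_ne_zero _
theorem H_ne_zero : T.H ≠ 0 := prod_equation_ne_zero _

theorem notMem_fB_of_mem_fA {l : Line K} (hA : l ∈ T.fA) : l ∉ T.fB := by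
  intro hB
  obtain ⟨r, s, hr, -, h⟩ := T.rep_fA l hA
  obtain ⟨r', s', -, -, h'⟩ := T.rep_fB l hB
  refine hr (T.eq_zero_of_combination (r := -s') (s := r) (t := s - r') ?_).2.1
  calc -s' • T.x.rep + r • T.y.rep + (s - r') • T.z.rep
      = (r • T.y.rep + s • T.z.rep) - (r' • T.z.rep + s' • T.x.rep) := by module
    _ = 0 := by rw [← h, ← h', sub_self]

theorem isRelPrime_F_G : IsRelPrime T.F T.G :=
  isRelPrime_prod_equation fun _ h => T.notMem_fB_of_mem_fA h

theorem ne_y_of_mem_fA {l : Line K} (hA : l ∈ T.fA) : l ≠ T.y := by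
  rintro rfl
  obtain ⟨r, s, -, hs, h⟩ := T.rep_fA _ hA
  refine hs (T.eq_zero_of_combination (r := 0) (s := r - 1) (t := s) ?_).2.2
  calc (0 : K) • T.x.rep + (r - 1) • T.y.rep + s • T.z.rep
      = (r • T.y.rep + s • T.z.rep) - T.y.rep := by module
    _ = 0 := by rw [← h, sub_self]

open Classical in
/-- The lines of the arrangement. -/
def lines : Finset (Line K) := {T.x, T.y, T.z} ∪ T.fA ∪ T.fB ∪ T.fC

theorem mem_lines {l : Line K} : l ∈ T.lines ↔
    l = T.x ∨ l = T.y ∨ l = T.z ∨ l ∈ T.fA ∨ l ∈ T.fB ∨ l ∈ T.fC := by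
  simp [lines]

/-- The equation of the arrangement. -/
def f : MvPolynomial (Fin 3) K := arrangementEquation T.lines

theorem isHomogeneous_f : T.f.IsHomogeneous T.lines.card := isHomogeneous_prod_equation _

theorem f_ne_zero : T.f ≠ 0 := prod_equation_ne_zero _

theorem card_lines_ne_zero : T.lines.card ≠ 0 :=
  Finset.card_ne_zero_of_mem (T.mem_lines.mpr (Or.inl rfl))

/-- The relation between a vector field `θ` which is tangent to the three sides, so that
`θ x = x p`, `θ y = y q` and `θ z = z r`, and the coefficients `u` of the syzygy
`F u₀ + G u₁ + H u₂ = 0` which it defines. -/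
def IsRelated (θ u : Fin 3 → MvPolynomial (Fin 3) K) : Prop :=
  ∃ p q r, lie θ T.x.equation = T.x.equation * p ∧ lie θ T.y.equation = T.y.equation * q ∧
    lie θ T.z.equation = T.z.equation * r ∧
    T.F * u 0 = q - r ∧ T.G * u 1 = r - p ∧ T.H * u 2 = p - q

/-- The triple `u` is a syzygy of `F`, `G`, `H`, homogeneous of total degree `n - 1`: this is the
syzygy of a vector field of degree `n`. -/
structure IsSyzygy (n : ℤ) (u : Fin 3 → MvPolynomial (Fin 3) K) : Prop where
  isForm_zero : IsForm (n - 1 - T.fA.card) (u 0)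
  isForm_one : IsForm (n - 1 - T.fB.card) (u 1)
  isForm_two : IsForm (n - 1 - T.fC.card) (u 2)
  eq_zero : T.F * u 0 + T.G * u 1 + T.H * u 2 = 0

variable {T}

theorem IsRelated.combination {θ η u v : Fin 3 → MvPolynomial (Fin 3) K}
    (hθ : T.IsRelated θ u) (hη : T.IsRelated η v) (g h : MvPolynomial (Fin 3) K) :
    T.IsRelated (fun k => g * θ k + h * η k) (fun k => g * u k + h * v k) := by
  obtain ⟨p, q, r, hp, hq, hr, h0, h1, h2⟩ := hθ
  obtain ⟨p', q', r', hp', hq', hr', h0', h1', h2'⟩ := hη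
  refine ⟨g * p + h * p', g * q + h * q', g * r + h * r', ?_, ?_, ?_, ?_, ?_, ?_⟩
  · rw [lie_combination, hp, hp']; ring
  · rw [lie_combination, hq, hq']; ring
  · rw [lie_combination, hr, hr']; ring
  · linear_combination g * h0 + h * h0'
  · linear_combination g * h1 + h * h1'
  · linear_combination g * h2 + h * h2'

theorem IsRelated.syzygy_unique {θ u v : Fin 3 → MvPolynomial (Fin 3) K}
    (hu : T.IsRelated θ u) (hv : T.IsRelated θ v) : u = v := by
  obtain ⟨p, q, r, hp, hq, hr, h0, h1, h2⟩ := hu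
  obtain ⟨p', q', r', hp', hq', hr', h0', h1', h2'⟩ := hv
  obtain rfl := mul_left_cancel₀ T.x.prime_equation.ne_zero (hp.symm.trans hp')
  obtain rfl := mul_left_cancel₀ T.y.prime_equation.ne_zero (hq.symm.trans hq')
  obtain rfl := mul_left_cancel₀ T.z.prime_equation.ne_zero (hr.symm.trans hr')
  funext k
  fin_cases k
  · exact mul_left_cancel₀ T.F_ne_zero (h0.trans h0'.symm)
  · exact mul_left_cancel₀ T.G_ne_zero (h1.trans h1'.symm)
  · exact mul_left_cancel₀ T.H_ne_zero (h2.trans h2'.symm)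

/-- A vector field is determined by its values on the equations of the three sides, and these
can be prescribed. -/
theorem exists_dual (T : TriangleData K) : ∃ M : Fin 3 → Fin 3 → K,
    (∀ (b₀ b₁ b₂ : MvPolynomial (Fin 3) K),
      lie (fun k => C (M k 0) * b₀ + C (M k 1) * b₁ + C (M k 2) * b₂) T.x.equation = b₀ ∧
      lie (fun k => C (M k 0) * b₀ + C (M k 1) * b₁ + C (M k 2) * b₂) T.y.equation = b₁ ∧
      lie (fun k => C (M k 0) * b₀ + C (M k 1) * b₁ + C (M k 2) * b₂) T.z.equation = b₂) ∧
    ∀ (θ : Fin 3 → MvPolynomial (Fin 3) K) (k : Fin 3),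
      θ k = C (M k 0) * lie θ T.x.equation + C (M k 1) * lie θ T.y.equation +
        C (M k 2) * lie θ T.z.equation := by
  obtain ⟨N, M, hN0, hN1, hN2, h1, h2⟩ : ∃ N M : Fin 3 → Fin 3 → K, T.x.rep = N 0 ∧
      T.y.rep = N 1 ∧ T.z.rep = N 2 ∧ (∀ i j, ∑ k, N i k * M k j = if i = j then 1 else 0) ∧
      ∀ i j, ∑ k, M i k * N k j = if i = j then 1 else 0 := by
    let N : Matrix (Fin 3) (Fin 3) K := Matrix.of ![T.x.rep, T.y.rep, T.z.rep]
    have hN : IsUnit N := Matrix.linearIndependent_rows_iff_isUnit.mp T.linearIndependent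
    have hdet : IsUnit N.det := (Matrix.isUnit_iff_isUnit_det N).mp hN
    refine ⟨N, (N⁻¹ : Matrix (Fin 3) (Fin 3) K), rfl, rfl, rfl, fun i j => ?_, fun i j => ?_⟩
    · rw [← Matrix.one_apply, ← Matrix.mul_nonsing_inv N hdet, Matrix.mul_apply]
    · rw [← Matrix.one_apply, ← Matrix.nonsing_inv_mul N hdet, Matrix.mul_apply]
  have e1 : ∀ i j, ∑ k, C (N i k) * C (M k j) =
      (C (if i = j then 1 else 0) : MvPolynomial (Fin 3) K) := by
    intro i j
    rw [← h1, map_sum]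
    simp
  have e2 : ∀ i j, ∑ k, C (M i k) * C (N k j) =
      (C (if i = j then 1 else 0) : MvPolynomial (Fin 3) K) := by
    intro i j
    rw [← h2, map_sum]
    simp
  have hx : ∀ θ, lie θ T.x.equation = ∑ i, C (N 0 i) * θ i := fun θ => by
    rw [← hN0]
    exact lie_linForm θ _
  have hy : ∀ θ, lie θ T.y.equation = ∑ i, C (N 1 i) * θ i := fun θ => by
    rw [← hN1]
    exact lie_linForm θ _
  have hz : ∀ θ, lie θ T.z.equation = ∑ i, C (N 2 i) * θ i := fun θ => by
    rw [← hN2]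
    exact lie_linForm θ _
  refine ⟨M, fun b₀ b₁ b₂ => ?_, fun θ k => ?_⟩
  · have key : ∀ i, ∑ k, C (N i k) * (C (M k 0) * b₀ + C (M k 1) * b₁ + C (M k 2) * b₂) =
        C (if i = 0 then 1 else 0) * b₀ + C (if i = 1 then 1 else 0) * b₁ +
          C (if i = 2 then 1 else 0) * b₂ := by
      intro i
      rw [← e1, ← e1, ← e1]
      simp only [Finset.sum_mul, ← Finset.sum_add_distrib]
      exact Finset.sum_congr rfl fun k _ => by ring
    rw [hx, hy, hz, key, key, key]
    simp
  · rw [hx, hy, hz]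
    have e3 : θ k = ∑ j, C (if k = j then 1 else 0) * θ j := by simp
    conv_lhs => rw [e3]
    simp only [← e2, Fin.sum_univ_three]
    ring

/-- A vector field that annihilates `f` is determined by its syzygy. -/
theorem eq_zero_of_isRelated_zero [CharZero K] {θ : Fin 3 → MvPolynomial (Fin 3) K}
    (hf : Annihilates θ T.f) (h : T.IsRelated θ 0) : θ = 0 := by
  obtain ⟨p, q, r, hp, hq, hr, h0, h1, h2⟩ := h
  simp only [Pi.zero_apply, mul_zero] at h0 h1 h2
  obtain rfl : q = r := sub_eq_zero.mp h0.symm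
  obtain rfl : p = q := sub_eq_zero.mp h2.symm
  obtain ⟨M, -, hM⟩ := T.exists_dual
  -- `θ` is a multiple of the Euler field
  have hθ : θ = fun k => p * X k := by
    have hl : ∀ l : Line K, lie (fun k => p * X k) l.equation = l.equation * p := by
      intro l
      rw [lie_X (n := 1) (isForm_natCast.mp (by exact_mod_cast l.isForm_equation))]
      simp [mul_comm]
    funext k
    rw [hM θ, hM (fun k => p * X k), hl, hl, hl, hp, hq, hr]
  rw [annihilates_iff, hθ, lie_X T.isHomogeneous_f] at hf
  have hN : (C (T.lines.card : K) : MvPolynomial (Fin 3) K) ≠ 0 := by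
    rw [Ne, C_eq_zero]
    exact_mod_cast T.card_lines_ne_zero
  have : p = 0 := (mul_eq_zero.mp hf).resolve_right (mul_ne_zero hN T.f_ne_zero)
  rw [hθ, this]
  funext k
  simp

/-- If `θ` is tangent to `l = r y + s z`, then `l` divides the difference of the multipliers of
`y` and `z`. -/
theorem F_dvd_sub {θ : Fin 3 → MvPolynomial (Fin 3) K} {q r : MvPolynomial (Fin 3) K}
    (h : ∀ l ∈ T.fA, l.equation ∣ lie θ l.equation)
    (hq : lie θ T.y.equation = T.y.equation * q) (hr : lie θ T.z.equation = T.z.equation * r) :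
    T.F ∣ q - r := by
  refine prod_equation_dvd fun l hl => ?_
  obtain ⟨a, b, ha, hb, hab⟩ := T.rep_fA l hl
  have e : l.equation = C a * T.y.equation + C b * T.z.equation := by
    rw [l.equation_eq, hab, linForm_combination]
    rfl
  have h1 : l.equation ∣ C a * (T.y.equation * (q - r)) := by
    obtain ⟨t, ht⟩ := h l hl
    refine ⟨t - r, ?_⟩
    rw [e, map_add, lie_C_mul, lie_C_mul, hq, hr] at ht
    rw [e]
    linear_combination ht
  have ha' : IsUnit (C a : MvPolynomial (Fin 3) K) := (isUnit_iff_ne_zero.mpr ha).map C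
  rw [ha'.dvd_mul_left] at h1
  exact (l.prime_equation.dvd_or_dvd h1).resolve_left
    (Line.not_equation_dvd (T.ne_y_of_mem_fA hl))

/-- Every homogeneous vector field that annihilates `f` defines a syzygy. -/
theorem exists_isRelated_of_annihilates {n : ℤ} {θ : Fin 3 → MvPolynomial (Fin 3) K}
    (hθ : ∀ k, IsForm n (θ k)) (hf : Annihilates θ T.f) :
    ∃ u, T.IsSyzygy n u ∧ T.IsRelated θ u := by
  have ht : ∀ l ∈ T.lines, l.equation ∣ lie θ l.equation := fun l hl => equation_dvd_lie hf hl
  have hform : ∀ l ∈ T.lines, ∃ p, IsForm (n - 1) p ∧ lie θ l.equation = l.equation * p := by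
    intro l hl
    obtain ⟨p, hp⟩ := ht l hl
    refine ⟨p, l.isForm_equation.of_mul l.prime_equation.ne_zero ?_, hp⟩
    rw [← hp]
    exact (isForm_lie (m := 1) hθ (isForm_natCast.mp (by exact_mod_cast l.isForm_equation))
      one_ne_zero).congr (by norm_num)
  obtain ⟨p, hp, hp'⟩ := hform T.x (by simp [mem_lines])
  obtain ⟨q, hq, hq'⟩ := hform T.y (by simp [mem_lines])
  obtain ⟨r, hr, hr'⟩ := hform T.z (by simp [mem_lines])
  obtain ⟨u₀, h0⟩ : T.F ∣ q - r :=
    T.F_dvd_sub (fun l hl => ht l (by simp [mem_lines, hl])) hq' hr'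
  obtain ⟨u₁, h1⟩ : T.G ∣ r - p :=
    T.rotate.F_dvd_sub (fun l hl => ht l (by
      have : l ∈ T.fB := hl
      simp [mem_lines, this])) hr' hp'
  obtain ⟨u₂, h2⟩ : T.H ∣ p - q :=
    T.rotate.rotate.F_dvd_sub (fun l hl => ht l (by
      have : l ∈ T.fC := hl
      simp [mem_lines, this])) hp' hq'
  refine ⟨![u₀, u₁, u₂], ⟨?_, ?_, ?_, ?_⟩, p, q, r, hp', hq', hr', h0.symm, h1.symm, h2.symm⟩
  · exact T.isForm_F.of_mul T.F_ne_zero (h0 ▸ (hq.sub hr).congr (by ring))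
  · exact T.isForm_G.of_mul T.G_ne_zero (h1 ▸ (hr.sub hp).congr (by ring))
  · exact T.isForm_H.of_mul T.H_ne_zero (h2 ▸ (hp.sub hq).congr (by ring))
  · change T.F * u₀ + T.G * u₁ + T.H * u₂ = 0
    rw [← h0, ← h1, ← h2]
    ring

/-- The converse of `F_dvd_sub`. -/
theorem equation_dvd_lie_of_F_dvd_sub {θ : Fin 3 → MvPolynomial (Fin 3) K}
    {q r : MvPolynomial (Fin 3) K} (hq : lie θ T.y.equation = T.y.equation * q)
    (hr : lie θ T.z.equation = T.z.equation * r) (h : T.F ∣ q - r) {l : Line K}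
    (hl : l ∈ T.fA) : l.equation ∣ lie θ l.equation := by
  obtain ⟨a, b, -, -, hab⟩ := T.rep_fA l hl
  have e : l.equation = C a * T.y.equation + C b * T.z.equation := by
    rw [l.equation_eq, hab, linForm_combination]
    rfl
  have h1 : lie θ l.equation = l.equation * r + C a * T.y.equation * (q - r) := by
    rw [e, map_add, lie_C_mul, lie_C_mul, hq, hr]
    ring
  rw [h1]
  exact dvd_add (dvd_mul_right _ _) (((Finset.dvd_prod_of_mem _ hl).trans h).mul_left _)

/-- Every homogeneous syzygy is defined by a vector field that annihilates `f`. -/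
theorem IsSyzygy.exists_isRelated [CharZero K] {n : ℤ} {u : Fin 3 → MvPolynomial (Fin 3) K}
    (hu : T.IsSyzygy n u) :
    ∃ θ, (∀ k, IsForm n (θ k)) ∧ Annihilates θ T.f ∧ T.IsRelated θ u := by
  obtain ⟨M, hM, -⟩ := T.exists_dual
  have hF : IsForm (n - 1) (T.F * u 0) := (T.isForm_F.mul hu.isForm_zero).congr (by ring)
  have hG : IsForm (n - 1) (T.G * u 1) := (T.isForm_G.mul hu.isForm_one).congr (by ring)
  -- the multipliers of `x`, `y`, `z` are only determined up to a common summand: take `r = 0`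
  let η : Fin 3 → MvPolynomial (Fin 3) K := fun k => C (M k 0) * (T.x.equation * -(T.G * u 1)) +
    C (M k 1) * (T.y.equation * (T.F * u 0)) + C (M k 2) * (T.z.equation * 0)
  obtain ⟨hx, hy, hz⟩ : lie η T.x.equation = T.x.equation * -(T.G * u 1) ∧
      lie η T.y.equation = T.y.equation * (T.F * u 0) ∧
      lie η T.z.equation = T.z.equation * 0 := hM _ _ _
  have hη : ∀ k, IsForm n (η k) := by
    intro k
    refine IsForm.add (IsForm.add ?_ ?_) ?_
    · exact ((IsForm.C _).mul (T.x.isForm_equation.mul hG.neg)).congr (by ring)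
    · exact ((IsForm.C _).mul (T.y.isForm_equation.mul hF)).congr (by ring)
    · rw [mul_zero, mul_zero]
      exact IsForm.zero _
  have ht : ∀ l ∈ T.lines, l.equation ∣ lie η l.equation := by
    intro l hl
    rcases T.mem_lines.mp hl with rfl | rfl | rfl | hl | hl | hl
    · exact ⟨_, hx⟩
    · exact ⟨_, hy⟩
    · exact ⟨_, hz⟩
    · exact T.equation_dvd_lie_of_F_dvd_sub hy hz (by rw [sub_zero]; exact dvd_mul_right _ _) hl
    · refine T.rotate.equation_dvd_lie_of_F_dvd_sub hz hx ?_ hl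
      exact ⟨u 1, by rw [sub_neg_eq_add, zero_add]; rfl⟩
    · refine T.rotate.rotate.equation_dvd_lie_of_F_dvd_sub hx hy ?_ hl
      exact ⟨u 2, by
        change _ = T.H * u 2
        linear_combination -hu.eq_zero⟩
  obtain ⟨h, hh⟩ := equation_dvd_lie_arrangementEquation ht
  have hhf : IsForm (n - 1) h := (isForm_natCast.mpr T.isHomogeneous_f).of_mul T.f_ne_zero (by
    change IsForm _ (arrangementEquation T.lines * h)
    rw [← hh]
    exact isForm_lie hη T.isHomogeneous_f T.card_lines_ne_zero)
  -- subtract a multiple of the Euler field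
  have hN : (T.lines.card : K) ≠ 0 := by exact_mod_cast T.card_lines_ne_zero
  have hl : ∀ l : Line K, lie (fun k => (-(C (T.lines.card : K)⁻¹ * h)) * X k) l.equation =
      l.equation * -(C (T.lines.card : K)⁻¹ * h) := by
    intro l
    rw [lie_X (n := 1) (isForm_natCast.mp (by exact_mod_cast l.isForm_equation))]
    simp [mul_comm]
  have hlie : ∀ p, lie (fun k => 1 * η k + 1 * ((-(C (T.lines.card : K)⁻¹ * h)) * X k)) p =
      lie η p + lie (fun k => (-(C (T.lines.card : K)⁻¹ * h)) * X k) p := by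
    intro p
    rw [lie_combination, one_mul, one_mul]
  refine ⟨fun k => 1 * η k + 1 * ((-(C (T.lines.card : K)⁻¹ * h)) * X k), fun k => ?_, ?_,
    -(T.G * u 1) - C (T.lines.card : K)⁻¹ * h, T.F * u 0 - C (T.lines.card : K)⁻¹ * h,
    0 - C (T.lines.card : K)⁻¹ * h, ?_, ?_, ?_, ?_, ?_, ?_⟩
  · simp only [one_mul]
    exact (hη k).add ((((IsForm.C _).mul hhf).neg.mul
      (isForm_natCast.mpr (isHomogeneous_X K k))).congr (by push_cast; ring))
  · rw [annihilates_iff, hlie, lie_X T.isHomogeneous_f]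
    have hC : (C (T.lines.card : K)⁻¹ * C (T.lines.card : K) : MvPolynomial (Fin 3) K) = 1 := by
      rw [← C_mul, inv_mul_cancel₀ hN, C_1]
    change lie η (arrangementEquation T.lines) + _ * (_ * arrangementEquation T.lines) = 0
    rw [hh]
    linear_combination (-(arrangementEquation T.lines) * h) * hC
  · rw [hlie, hl, hx]; ring
  · rw [hlie, hl, hy]; ring
  · rw [hlie, hl, hz]; ring
  · ring
  · ring
  · linear_combination hu.eq_zero

/-! ### Exponents of a splitting -/

theorem H_mem_of_mul_C {r : K} (hr : r ≠ 0) {s t : MvPolynomial (Fin 3) K}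
    (h : T.F * s + T.G * t + T.H * C r = 0) : T.H ∈ Ideal.span {T.F, T.G} := by
  rw [Ideal.mem_span_pair]
  refine ⟨-(s * C r⁻¹), -(t * C r⁻¹), ?_⟩
  have hC : (C r * C r⁻¹ : MvPolynomial (Fin 3) K) = 1 := by
    rw [← C_mul, mul_inv_cancel₀ hr, C_1]
  linear_combination (-C r⁻¹) * h + T.H * hC

/-- A syzygy whose last coefficient vanishes is a multiple of the Koszul syzygy of `F`
and `G`. -/
theorem IsSyzygy.exists_koszul {n : ℤ} {u : Fin 3 → MvPolynomial (Fin 3) K}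
    (hu : T.IsSyzygy n u) (h2 : u 2 = 0) :
    ∃ t, IsForm (n - 1 - T.fA.card - T.fB.card) t ∧ u 0 = T.G * t ∧ u 1 = -(T.F * t) := by
  have h := hu.eq_zero
  rw [h2, mul_zero, add_zero] at h
  have hd : T.G ∣ T.F * u 0 := ⟨-u 1, by linear_combination h⟩
  obtain ⟨t, ht⟩ := T.isRelPrime_F_G.symm.dvd_of_dvd_mul_left hd
  refine ⟨t, T.isForm_G.of_mul T.G_ne_zero ?_, ht, mul_left_cancel₀ T.G_ne_zero ?_⟩
  · rw [← ht]
    exact hu.isForm_zero.congr (by ring)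
  · rw [ht] at h
    linear_combination h

/-- The Hilbert–Burch description of the syzygies `u` and `v` of two generators: their
`2 × 2` minors are `F`, `G`, `H` up to a common nonzero constant. -/
theorem exists_minors_eq [CharZero K] {d₁ d₂ : ℤ} {σ τ : Fin 3 → MvPolynomial (Fin 3) K}
    (h : IsGeneratingPair T.f d₁ d₂ σ τ) :
    ∃ u v, T.IsSyzygy d₁ u ∧ T.IsSyzygy d₂ v ∧ ∃ w : K, w ≠ 0 ∧
      u 1 * v 2 - u 2 * v 1 = T.F * C w ∧ u 2 * v 0 - u 0 * v 2 = T.G * C w ∧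
      u 0 * v 1 - u 1 * v 0 = T.H * C w := by
  obtain ⟨u, hu, hσ⟩ := exists_isRelated_of_annihilates h.isForm_left h.annihilates_left
  obtain ⟨v, hv, hτ⟩ := exists_isRelated_of_annihilates h.isForm_right h.annihilates_right
  have hspan : ∀ (n : ℤ) w, T.IsSyzygy n w → ∃ g g', ∀ k, w k = g * u k + g' * v k := by
    intro n w hw
    obtain ⟨θ, hθ, hf, hr⟩ := hw.exists_isRelated
    obtain ⟨g, g', -, -, he⟩ := h.exists_eq n θ hθ hf
    obtain rfl : θ = fun k => g * σ k + g' * τ k := funext he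
    exact ⟨g, g', congrFun (hr.syzygy_unique (hσ.combination hτ g g'))⟩
  have eu := hu.eq_zero
  have ev := hv.eq_zero
  obtain ⟨w, hw⟩ : T.F ∣ u 1 * v 2 - u 2 * v 1 := by
    refine T.isRelPrime_F_G.dvd_of_dvd_mul_left (z := u 1 * v 2 - u 2 * v 1)
      ⟨u 2 * v 0 - u 0 * v 2, ?_⟩
    linear_combination v 2 * eu - u 2 * ev
  have hw1 : u 2 * v 0 - u 0 * v 2 = T.G * w := by
    refine mul_left_cancel₀ T.F_ne_zero ?_
    linear_combination (-v 2) * eu + u 2 * ev + T.G * hw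
  have hw2 : u 0 * v 1 - u 1 * v 0 = T.H * w := by
    refine mul_left_cancel₀ T.F_ne_zero ?_
    linear_combination v 1 * eu - u 1 * ev + T.H * hw
  -- the minors of two Koszul syzygies are multiples of those of the generators
  have hdvd : ∀ (n m : ℤ) p q, T.IsSyzygy n p → T.IsSyzygy m q →
      T.H * w ∣ p 0 * q 1 - p 1 * q 0 := by
    intro n m p q hp hq
    obtain ⟨g, g', hg⟩ := hspan n p hp
    obtain ⟨k, k', hk⟩ := hspan m q hq
    refine ⟨g * k' - g' * k, ?_⟩
    rw [← hw2, hg, hg, hk, hk]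
    ring
  have k1 : T.IsSyzygy (T.fA.card + T.fB.card + 1) ![T.G, -T.F, 0] :=
    ⟨T.isForm_G.congr (by ring), T.isForm_F.neg.congr (by ring), IsForm.zero _, by
      change T.F * T.G + T.G * -T.F + T.H * 0 = 0
      ring⟩
  have k2 : T.IsSyzygy (T.fA.card + T.fC.card + 1) ![T.H, 0, -T.F] :=
    ⟨T.isForm_H.congr (by ring), IsForm.zero _, T.isForm_F.neg.congr (by ring), by
      change T.F * T.H + T.G * 0 + T.H * -T.F = 0
      ring⟩
  have k3 : T.IsSyzygy (T.fB.card + T.fC.card + 1) ![0, T.H, -T.G] :=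
    ⟨IsForm.zero _, T.isForm_H.congr (by ring), T.isForm_G.neg.congr (by ring), by
      change T.F * 0 + T.G * T.H + T.H * -T.G = 0
      ring⟩
  have hwF : w ∣ T.F := by
    have := hdvd _ _ _ _ k1 k2
    change T.H * w ∣ T.G * 0 - -T.F * T.H at this
    rw [show T.G * 0 - -T.F * T.H = T.H * T.F by ring] at this
    exact (mul_dvd_mul_iff_left T.H_ne_zero).mp this
  have hwG : w ∣ T.G := by
    have := hdvd _ _ _ _ k1 k3
    change T.H * w ∣ T.G * T.H - -T.F * 0 at this
    rw [show T.G * T.H - -T.F * 0 = T.H * T.G by ring] at this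
    exact (mul_dvd_mul_iff_left T.H_ne_zero).mp this
  obtain ⟨r, hr, rfl⟩ := (MvPolynomial.isUnit_iff_eq_C_of_isReduced (P := w)).mp
    (T.isRelPrime_F_G hwF hwG)
  exact ⟨u, v, hu, hv, r, hr.ne_zero, hw, hw1, hw2⟩

/-- In degrees less than `c` a syzygy is a multiple of the Koszul syzygy of `F` and `G`, whose
degree is `a + b - 1`. -/
theorem IsSyzygy.min_le {n : ℤ} {u : Fin 3 → MvPolynomial (Fin 3) K}
    (hu : T.IsSyzygy n u) (h0 : u ≠ 0) :
    min (T.fA.card + T.fB.card + 1 : ℤ) (T.fC.card + 1) ≤ n := by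
  by_contra! hn
  rw [lt_min_iff] at hn
  have h2 : u 2 = 0 := hu.isForm_two.eq_zero_of_neg (by omega)
  obtain ⟨t, ht, e0, e1⟩ := hu.exists_koszul h2
  obtain rfl := ht.eq_zero_of_neg (by omega)
  apply h0
  funext k
  fin_cases k <;> simp [e0, e1, h2]

/-- The exponents of a splitting add up to the number of lines minus one, and they are bounded
below like the degrees of all nonzero syzygies. -/
theorem exponents_of_isGeneratingPair [CharZero K] {d₁ d₂ : ℤ}
    {σ τ : Fin 3 → MvPolynomial (Fin 3) K} (h : IsGeneratingPair T.f d₁ d₂ σ τ) :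
    d₁ + d₂ = T.fA.card + T.fB.card + T.fC.card + 2 ∧
      min (T.fA.card + T.fB.card + 1 : ℤ) (T.fC.card + 1) ≤ d₁ ∧
      min (T.fA.card + T.fB.card + 1 : ℤ) (T.fC.card + 1) ≤ d₂ := by
  obtain ⟨u, v, hu, hv, w, hw, h0, h1, h2⟩ := exists_minors_eq h
  have hne : T.H * C w ≠ 0 := mul_ne_zero T.H_ne_zero (by simpa using hw)
  refine ⟨?_, hu.min_le ?_, hv.min_le ?_⟩
  · have e1 : IsForm (d₁ + d₂ - 2 - T.fA.card - T.fB.card) (T.H * C w) := by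
      rw [← h2]
      exact ((hu.isForm_zero.mul hv.isForm_one).congr (by ring)).sub
        ((hu.isForm_one.mul hv.isForm_zero).congr (by ring))
    obtain ⟨k, hk, hk'⟩ := e1.exists_nat hne
    have e2 : (T.H * C w).IsHomogeneous T.fC.card :=
      isForm_natCast.mp ((T.isForm_H.mul (IsForm.C w)).congr (add_zero _))
    have := hk'.inj_right e2 hne
    omega
  · rintro rfl
    exact hne (by rw [← h2]; simp)
  · rintro rfl
    exact hne (by rw [← h2]; simp)

/-- For exponents `(a + b - 1, c)` the last coefficient of one of the two generating syzygies is a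
nonzero constant. -/
theorem H_mem_of_isGeneratingPair [CharZero K] {σ τ : Fin 3 → MvPolynomial (Fin 3) K}
    (h : IsGeneratingPair T.f (T.fA.card + T.fB.card + 1) (T.fC.card + 1) σ τ) :
    T.H ∈ Ideal.span {T.F, T.G} := by
  obtain ⟨u, v, hu, hv, w, hw, h0, h1, h2⟩ := exists_minors_eq h
  have hF : T.F * C w ≠ 0 := mul_ne_zero T.F_ne_zero (by simpa using hw)
  have hv2 := (hv.isForm_two.congr (n := 0) (by ring)).eq_C
  by_cases hr : coeff 0 (v 2) = 0
  · -- then the second syzygy is a multiple of the Koszul syzygy, whose degree is at least that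
    -- of the first one, so that the last coefficient of the first syzygy is a constant
    rw [hr, C_0] at hv2
    obtain ⟨t, ht, e0, e1⟩ := hv.exists_koszul hv2
    have ht0 : t ≠ 0 := by
      rintro rfl
      exact hF (by rw [← h0, hv2, e1]; simp)
    have hu2 : u 2 ≠ 0 := by
      intro h
      exact hF (by rw [← h0, hv2, h]; simp)
    obtain ⟨k, hk, -⟩ := ht.exists_nat ht0
    obtain ⟨l, hl, -⟩ := hu.isForm_two.exists_nat hu2
    have hC := (hu.isForm_two.congr (n := 0) (by omega)).eq_C
    refine H_mem_of_mul_C (r := coeff 0 (u 2)) (s := u 0) (t := u 1) ?_ (hC ▸ hu.eq_zero)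
    intro h
    rw [h, C_0] at hC
    exact hu2 hC
  · exact H_mem_of_mul_C hr (hv2 ▸ hv.eq_zero)

/-- If `H = F s + G t`, then the syzygies are free on `(G, -F, 0)` and `(s, t, -1)`. -/
theorem nonempty_splitting_of_H_mem [CharZero K] (h : T.H ∈ Ideal.span {T.F, T.G}) :
    Nonempty (Splitting T.f (T.fA.card + T.fB.card + 1) (T.fC.card + 1)) := by
  have : Infinite K := inferInstance
  obtain ⟨s, t, hs, ht, hst⟩ : ∃ s t, IsForm (T.fC.card - T.fA.card : ℤ) s ∧
      IsForm (T.fC.card - T.fB.card : ℤ) t ∧ T.F * s + T.G * t = T.H := by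
    obtain ⟨s, t, hst⟩ := Ideal.mem_span_pair.mp h
    refine ⟨_, _, isForm_formComponent _ s, isForm_formComponent _ t, ?_⟩
    rw [← formComponent_mul T.isForm_F, ← formComponent_mul T.isForm_G, ← map_add,
      ← T.isForm_H.formComponent_eq, ← hst, mul_comm s, mul_comm t]
  have hu : T.IsSyzygy (T.fA.card + T.fB.card + 1) ![T.G, -T.F, 0] :=
    ⟨T.isForm_G.congr (by ring), T.isForm_F.neg.congr (by ring), IsForm.zero _, by
      change T.F * T.G + T.G * -T.F + T.H * 0 = 0
      ring⟩
  have hv : T.IsSyzygy (T.fC.card + 1) ![s, t, -1] :=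
    ⟨hs.congr (by ring), ht.congr (by ring), by
      change IsForm _ (-1)
      rw [← C_1]
      exact (IsForm.C 1).neg.congr (by ring), by
      change T.F * s + T.G * t + T.H * -1 = 0
      rw [hst]
      ring⟩
  obtain ⟨σ, hσ, hσf, hσu⟩ := hu.exists_isRelated
  obtain ⟨τ, hτ, hτf, hτv⟩ := hv.exists_isRelated
  have hann : ∀ θ η : Fin 3 → MvPolynomial (Fin 3) K, Annihilates θ T.f → Annihilates η T.f →
      ∀ g g', Annihilates (fun k => g * θ k + g' * η k) T.f := by
    intro θ η hθ hη g g'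
    rw [annihilates_iff] at hθ hη ⊢
    rw [lie_combination, hθ, hη]
    simp
  have hpair : IsGeneratingPair T.f (T.fA.card + T.fB.card + 1) (T.fC.card + 1) σ τ := by
    refine ⟨hσ, hτ, hσf, hτf, fun n θ hθ hf => ?_⟩
    obtain ⟨w, hw, hθw⟩ := exists_isRelated_of_annihilates hθ hf
    -- the syzygy `w + w₂ (s, t, -1)` has vanishing last coefficient
    have hw' : T.IsSyzygy n ![w 0 + w 2 * s, w 1 + w 2 * t, 0] :=
      ⟨hw.isForm_zero.add ((hw.isForm_two.mul hs).congr (by ring)),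
        hw.isForm_one.add ((hw.isForm_two.mul ht).congr (by ring)), IsForm.zero _, by
        change T.F * (w 0 + w 2 * s) + T.G * (w 1 + w 2 * t) + T.H * 0 = 0
        linear_combination hw.eq_zero + w 2 * hst⟩
    obtain ⟨g, hg, e0, e1⟩ := hw'.exists_koszul rfl
    change w 0 + w 2 * s = T.G * g at e0
    change w 1 + w 2 * t = -(T.F * g) at e1
    refine ⟨g, -w 2, hg.congr (by ring), hw.isForm_two.neg.congr (by ring), fun k => ?_⟩
    have hcomb : (fun k => g * ![T.G, -T.F, 0] k + -w 2 * ![s, t, -1] k) = w := by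
      funext k
      fin_cases k
      · change g * T.G + -w 2 * s = w 0
        linear_combination -e0
      · change g * -T.F + -w 2 * t = w 1
        linear_combination -e1
      · change g * 0 + -w 2 * -1 = w 2
        ring
    have hrel := hσu.combination hτv g (-w 2)
    rw [hcomb] at hrel
    have hzero := hθw.combination hrel 1 (-1)
    have h0 : (fun k => 1 * w k + -1 * w k) = 0 := by
      funext k
      simp
    rw [h0] at hzero
    have := congrFun (eq_zero_of_isRelated_zero
      (hann _ _ hf (hann _ _ hσf hτf g (-w 2)) 1 (-1)) hzero) k
    simp only [Pi.zero_apply] at this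
    linear_combination this
  refine hpair.nonempty_splitting fun g g' hgg => ?_
  have hrel := hσu.combination hτv g g'
  rw [funext hgg] at hrel
  have hzero : T.IsRelated (fun _ => 0) 0 := by
    refine ⟨0, 0, 0, ?_, ?_, ?_, ?_, ?_, ?_⟩ <;> simp [lie_apply]
  have he := congrFun (hrel.syzygy_unique hzero)
  have h2 : g * 0 + g' * -1 = 0 := he 2
  have h0 : g * T.G + g' * s = 0 := he 0
  have hg' : g' = 0 := by linear_combination -h2
  rw [hg', zero_mul, add_zero] at h0
  exact ⟨(mul_eq_zero.mp h0).resolve_right T.G_ne_zero, hg'⟩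

end TriangleData

/-! ### The ideal of a grid -/

section Grid

variable {R ι κ : Type*} [CommRing R] {f : ι → R}

/-- An element that lies in all the ideals `(fᵢ, g)` lies in the ideal `(∏ fᵢ, g)`. -/
theorem mem_span_prod_left {s : Finset ι} {g p : R}
    (hprime : ∀ i ∈ s, (Ideal.span {f i, g}).IsPrime)
    (hf : ∀ i ∈ s, ∀ k ∈ s, k ≠ i → f k ∉ Ideal.span {f i, g})
    (h : ∀ i ∈ s, p ∈ Ideal.span {f i, g}) : p ∈ Ideal.span {∏ i ∈ s, f i, g} := by
  classical
  induction s using Finset.induction_on with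
  | empty => exact Ideal.mem_span_pair.mpr ⟨p, 0, by simp⟩
  | insert k s hk ih =>
    have hks := Finset.mem_insert_self k s
    have hs : ∀ i ∈ s, i ∈ insert k s := fun i hi => Finset.mem_insert_of_mem hi
    obtain ⟨a, b, hab⟩ := Ideal.mem_span_pair.mp (ih (fun i hi => hprime i (hs i hi))
      (fun i hi j hj => hf i (hs i hi) j (hs j hj)) fun i hi => h i (hs i hi))
    have hP := hprime k hks
    have h1 : a * ∏ i ∈ s, f i ∈ Ideal.span {f k, g} := by
      have h2 : b * g ∈ Ideal.span {f k, g} :=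
        Ideal.mul_mem_left _ _ (Ideal.subset_span (by simp))
      have h3 := sub_mem (h k hks) h2
      rwa [← hab, add_sub_cancel_right] at h3
    have h4 : ∏ i ∈ s, f i ∉ Ideal.span {f k, g} := fun h5 => by
      obtain ⟨i, hi, h6⟩ := hP.prod_mem_iff.mp h5
      exact hf k hks i (hs i hi) (fun e => hk (e ▸ hi)) h6
    obtain ⟨c, d, hcd⟩ := Ideal.mem_span_pair.mp ((hP.mem_or_mem h1).resolve_right h4)
    rw [Finset.prod_insert hk, Ideal.mem_span_pair]
    exact ⟨c, d * (∏ i ∈ s, f i) + b, by rw [← hab, ← hcd]; ring⟩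

/-- An element that lies in all the ideals `(fᵢ, gⱼ)` lies in the ideal `(∏ fᵢ, ∏ gⱼ)`. -/
theorem mem_span_prod_prod {s : Finset ι} {t : Finset κ} {g : κ → R} {p : R}
    (hprime : ∀ i ∈ s, ∀ j ∈ t, (Ideal.span {f i, g j}).IsPrime)
    (hf : ∀ i ∈ s, ∀ j ∈ t, ∀ k ∈ s, k ≠ i → f k ∉ Ideal.span {f i, g j})
    (hg : ∀ i ∈ s, ∀ j ∈ t, ∀ k ∈ t, k ≠ j → g k ∉ Ideal.span {f i, g j})
    (h : ∀ i ∈ s, ∀ j ∈ t, p ∈ Ideal.span {f i, g j}) :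
    p ∈ Ideal.span {∏ i ∈ s, f i, ∏ j ∈ t, g j} := by
  classical
  induction t using Finset.induction_on with
  | empty => exact Ideal.mem_span_pair.mpr ⟨0, p, by simp⟩
  | insert k t hk ih =>
    have hkt := Finset.mem_insert_self k t
    have ht : ∀ j ∈ t, j ∈ insert k t := fun j hj => Finset.mem_insert_of_mem hj
    obtain ⟨a, b, hab⟩ := Ideal.mem_span_pair.mp (ih (fun i hi j hj => hprime i hi j (ht j hj))
      (fun i hi j hj => hf i hi j (ht j hj))
      (fun i hi j hj l hl => hg i hi j (ht j hj) l (ht l hl)) fun i hi j hj => h i hi j (ht j hj))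
    have hb : b ∈ Ideal.span {∏ i ∈ s, f i, g k} := by
      refine mem_span_prod_left (fun i hi => hprime i hi k hkt) (fun i hi => hf i hi k hkt)
        fun i hi => ?_
      have hP := hprime i hi k hkt
      have h1 : b * ∏ j ∈ t, g j ∈ Ideal.span {f i, g k} := by
        have h2 : a * ∏ i ∈ s, f i ∈ Ideal.span {f i, g k} :=
          Ideal.mul_mem_left _ _ (Ideal.mem_of_dvd _ (Finset.dvd_prod_of_mem f hi)
            (Ideal.subset_span (by simp)))
        have h3 := sub_mem (h i hi k hkt) h2
        rwa [← hab, add_sub_cancel_left] at h3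
      refine (hP.mem_or_mem h1).resolve_right fun h4 => ?_
      obtain ⟨j, hj, h5⟩ := hP.prod_mem_iff.mp h4
      exact hg i hi k hkt j (ht j hj) (fun e => hk (e ▸ hj)) h5
    obtain ⟨c, d, hcd⟩ := Ideal.mem_span_pair.mp hb
    rw [Finset.prod_insert hk, Ideal.mem_span_pair]
    exact ⟨a + c * ∏ j ∈ t, g j, d, by rw [← hab, ← hcd]; ring⟩

end Grid

/-! ### Points and lines -/

theorem orthogonal_iff_rep (p l : ℙ K (Fin 3 → K)) :
    Projectivization.orthogonal l p ↔ l.rep ⬝ᵥ p.rep = 0 := by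
  conv_lhs => rw [← l.mk_rep, ← p.mk_rep]
  exact Projectivization.orthogonal_mk _ _

theorem onLine_iff {p : Plane K} {l : Line K} : OnLine p l ↔ l.rep ⬝ᵥ Projectivization.rep p = 0 :=
  orthogonal_iff_rep p l

theorem onLine_mk_iff {v : Fin 3 → K} (hv : v ≠ 0) {l : Line K} :
    OnLine (Projectivization.mk K v hv) l ↔ eval v l.equation = 0 := by
  rw [Line.equation_eq, eval_linForm, ← Projectivization.orthogonal_mk l.rep_nonzero hv,
    l.mk_rep]
  rfl

theorem onLine_iff_eval {p : Plane K} {l : Line K} :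
    OnLine p l ↔ eval (Projectivization.rep p) l.equation = 0 := by
  rw [onLine_iff, Line.equation_eq, eval_linForm]

theorem crossProduct_rep_ne_zero {l m : Line K} (h : l ≠ m) : crossProduct l.rep m.rep ≠ 0 := by
  intro h0
  apply h
  rw [← l.mk_rep, ← m.mk_rep]
  exact (Projectivization.mk_eq_mk_iff_crossProduct_eq_zero _ _).mpr h0

theorem crossProduct_crossProduct_eq_zero {a b v : Fin 3 → K} (ha : a ⬝ᵥ v = 0)
    (hb : b ⬝ᵥ v = 0) : crossProduct v (crossProduct a b) = 0 := by
  rw [cross_apply, cross_apply]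
  simp only [dotProduct, Fin.sum_univ_three] at ha hb
  ext i
  fin_cases i <;> simp
  · linear_combination a 0 * hb - b 0 * ha
  · linear_combination a 1 * hb - b 1 * ha
  · linear_combination a 2 * hb - b 2 * ha

/-- The intersection point of two distinct lines is given by the cross product. -/
theorem exists_crossProduct_eq_smul {l m : Line K} (h : l ≠ m) {p : Plane K} (hl : OnLine p l)
    (hm : OnLine p m) :
    ∃ r : K, r ≠ 0 ∧ crossProduct l.rep m.rep = r • Projectivization.rep p := by
  have h1 := (Projectivization.mk_eq_mk_iff_crossProduct_eq_zero
    (Projectivization.rep_nonzero p) (crossProduct_rep_ne_zero h)).mpr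
    (crossProduct_crossProduct_eq_zero (onLine_iff.mp hl) (onLine_iff.mp hm))
  obtain ⟨r, hr⟩ := (Projectivization.mk_eq_mk_iff' _ _ _ _ _).mp h1.symm
  refine ⟨r, ?_, hr.symm⟩
  rintro rfl
  exact crossProduct_rep_ne_zero h (by rw [← hr, zero_smul])

theorem exists_onLine_onLine {l m : Line K} (h : l ≠ m) :
    ∃ p : Plane K, OnLine p l ∧ OnLine p m := by
  classical
  exact ⟨_, Projectivization.orthogonal_cross_left h, Projectivization.orthogonal_cross_right h⟩

theorem point_unique {l m : Line K} (h : l ≠ m) {p q : Plane K} (hpl : OnLine p l)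
    (hpm : OnLine p m) (hql : OnLine q l) (hqm : OnLine q m) : p = q := by
  obtain ⟨r, hr, hp⟩ := exists_crossProduct_eq_smul h hpl hpm
  obtain ⟨s, hs, hq⟩ := exists_crossProduct_eq_smul h hql hqm
  have key : ∀ p q : ℙ K (Fin 3 → K), r • p.rep = s • q.rep → p = q := by
    intro p q hpq
    rw [← p.mk_rep, ← q.mk_rep, Projectivization.mk_eq_mk_iff']
    exact ⟨r⁻¹ * s, by rw [mul_smul, ← hpq, smul_smul, inv_mul_cancel₀ hr, one_smul]⟩
  exact key p q (hp.symm.trans hq)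

theorem exists_line_through {p q : Plane K} (h : p ≠ q) :
    ∃ l : Line K, OnLine p l ∧ OnLine q l := by
  obtain ⟨l, h1, h2⟩ := exists_onLine_onLine (l := p) (m := q) h
  exact ⟨l, Projectivization.orthogonal_comm.mp h1, Projectivization.orthogonal_comm.mp h2⟩

theorem line_unique {p q : Plane K} (h : p ≠ q) {l m : Line K} (hpl : OnLine p l)
    (hql : OnLine q l) (hpm : OnLine p m) (hqm : OnLine q m) : l = m := by
  by_contra hlm
  exact h (point_unique hlm hpl hpm hql hqm)

/-- The polynomials that vanish on the line of `K³` spanned by `v`. -/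
theorem ker_aeval_eq_span {l m : Line K} (h : l ≠ m) {p : Plane K} (hl : OnLine p l)
    (hm : OnLine p m) :
    RingHom.ker (aeval fun i => Polynomial.C (Projectivization.rep p i) * Polynomial.X :
      MvPolynomial (Fin 3) K →ₐ[K] Polynomial K) = Ideal.span {l.equation, m.equation} := by
  set φ : MvPolynomial (Fin 3) K →ₐ[K] Polynomial K :=
    aeval fun i => Polynomial.C (Projectivization.rep p i) * Polynomial.X with hφ
  have hφl : ∀ l : Line K, OnLine p l → φ l.equation = 0 := by
    intro l hl
    have hl' := onLine_iff.mp hl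
    simp only [dotProduct, Fin.sum_univ_three] at hl'
    have h1 := congrArg (Polynomial.C (R := K)) hl'
    simp only [Polynomial.C_add, Polynomial.C_mul, Polynomial.C_0] at h1
    have e : φ l.equation = ∑ i, Polynomial.C (l.rep i) *
        (Polynomial.C (Projectivization.rep p i) * Polynomial.X) := by
      rw [Line.equation, map_sum]
      refine Finset.sum_congr rfl fun i _ => ?_
      rw [map_mul, hφ, aeval_X, algHom_C, Polynomial.algebraMap_eq]
    rw [e, Fin.sum_univ_three]
    linear_combination Polynomial.X * h1
  refine le_antisymm (fun q hq => ?_) (Ideal.span_le.mpr ?_)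
  · obtain ⟨k, hk⟩ := Function.ne_iff.mp (Projectivization.rep_nonzero p)
    rw [Pi.zero_apply] at hk
    obtain ⟨r, hr0, hr⟩ := exists_crossProduct_eq_smul h hl hm
    have hmem : ∀ i, X i - C (Projectivization.rep p i * (Projectivization.rep p k)⁻¹) * X k ∈
        Ideal.span {l.equation, m.equation} := by
      intro i
      -- by the vector triple product, the coordinates of `(l × m) × X` are combinations of the
      -- equations, and `l × m` is a multiple of the coordinate vector of `p`
      have h1 : C (crossProduct l.rep m.rep k) * X i - C (crossProduct l.rep m.rep i) * X k ∈
          Ideal.span {l.equation, m.equation} := by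
        rw [Ideal.mem_span_pair]
        simp only [Line.equation, Fin.sum_univ_three, cross_apply]
        fin_cases k <;> fin_cases i <;> simp
        · exact ⟨0, 0, by ring⟩
        · exact ⟨C (m.rep 2), -C (l.rep 2), by ring⟩
        · exact ⟨-C (m.rep 1), C (l.rep 1), by ring⟩
        · exact ⟨-C (m.rep 2), C (l.rep 2), by ring⟩
        · exact ⟨0, 0, by ring⟩
        · exact ⟨C (m.rep 0), -C (l.rep 0), by ring⟩
        · exact ⟨C (m.rep 1), -C (l.rep 1), by ring⟩
        · exact ⟨-C (m.rep 0), C (l.rep 0), by ring⟩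
        · exact ⟨0, 0, by ring⟩
      rw [hr] at h1
      have h2 := Ideal.mul_mem_left _ (C (r * Projectivization.rep p k)⁻¹) h1
      have e1 : (C (r * Projectivization.rep p k)⁻¹ * C (r * Projectivization.rep p k) :
          MvPolynomial (Fin 3) K) = 1 := by
        rw [← C_mul, inv_mul_cancel₀ (mul_ne_zero hr0 hk), C_1]
      have e2 : (C (r * Projectivization.rep p k)⁻¹ * C (r * Projectivization.rep p i) :
          MvPolynomial (Fin 3) K) =
            C (Projectivization.rep p i * (Projectivization.rep p k)⁻¹) := by
        rw [← C_mul]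
        congr 1
        field_simp
      simp only [Pi.smul_apply, smul_eq_mul] at h2
      rwa [mul_sub, ← mul_assoc, ← mul_assoc, e1, e2, one_mul] at h2
    let ψ : Polynomial K →ₐ[K] MvPolynomial (Fin 3) K :=
      Polynomial.aeval (C (Projectivization.rep p k)⁻¹ * X k)
    have hcomp : (Ideal.Quotient.mkₐ K (Ideal.span {l.equation, m.equation})).comp (ψ.comp φ) =
        Ideal.Quotient.mkₐ K (Ideal.span {l.equation, m.equation}) := by
      refine MvPolynomial.algHom_ext fun i => ?_
      simp only [AlgHom.comp_apply, Ideal.Quotient.mkₐ_eq_mk]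
      rw [eq_comm, Ideal.Quotient.mk_eq_mk_iff_sub_mem]
      have : ψ (φ (X i)) = C (Projectivization.rep p i * (Projectivization.rep p k)⁻¹) * X k := by
        simp [hφ, ψ, mul_assoc, algebraMap_eq]
      rw [this]
      exact hmem i
    have h3 := DFunLike.congr_fun hcomp q
    simp only [AlgHom.comp_apply, Ideal.Quotient.mkₐ_eq_mk] at h3
    rw [← Ideal.Quotient.eq_zero_iff_mem, ← h3, show φ q = 0 from hq, map_zero, map_zero]
  · rintro q (rfl | rfl)
    · exact hφl _ hl
    · exact hφl _ hm

theorem isPrime_span_equation {l m : Line K} (h : l ≠ m) :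
    (Ideal.span {l.equation, m.equation}).IsPrime := by
  obtain ⟨p, hl, hm⟩ := exists_onLine_onLine h
  rw [← ker_aeval_eq_span h hl hm]
  exact RingHom.ker_isPrime _

/-- A polynomial that vanishes on the punctured cone over the intersection point of two lines is
a combination of their equations. -/
theorem mem_span_equation [Infinite K] {l m : Line K} (h : l ≠ m) {p : Plane K} (hl : OnLine p l)
    (hm : OnLine p m) {q : MvPolynomial (Fin 3) K}
    (hq : ∀ t : K, t ≠ 0 → eval (t • Projectivization.rep p) q = 0) :
    q ∈ Ideal.span {l.equation, m.equation} := by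
  rw [← ker_aeval_eq_span h hl hm, RingHom.mem_ker]
  set φ : MvPolynomial (Fin 3) K →ₐ[K] Polynomial K :=
    aeval fun i => Polynomial.C (Projectivization.rep p i) * Polynomial.X with hφ
  have h1 : φ q * Polynomial.X = 0 := by
    refine Polynomial.funext fun t => ?_
    rcases eq_or_ne t 0 with rfl | ht
    · simp
    have h2 : (Polynomial.aeval t).comp φ = aeval (t • Projectivization.rep p) := by
      refine MvPolynomial.algHom_ext fun i => ?_
      rw [AlgHom.comp_apply, hφ, aeval_X, aeval_X, map_mul, Polynomial.aeval_C,
        Polynomial.aeval_X]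
      exact mul_comm _ _
    have h3 : Polynomial.eval t (φ q) = eval (t • Projectivization.rep p) q := by
      simpa [aeval_eq_eval, Polynomial.aeval_def] using DFunLike.congr_fun h2 q
    rw [Polynomial.eval_mul, h3, hq t ht, zero_mul, Polynomial.eval_zero]
  exact (mul_eq_zero.mp h1).resolve_right Polynomial.X_ne_zero

theorem eval_eq_zero_of_mem_span {p q r : MvPolynomial (Fin 3) K} {v : Fin 3 → K}
    (hp : eval v p = 0) (hq : eval v q = 0) (h : r ∈ Ideal.span {p, q}) : eval v r = 0 := by
  obtain ⟨a, b, rfl⟩ := Ideal.mem_span_pair.mp h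
  simp [hp, hq]

theorem eval_prod_equation_eq_zero_iff {s : Finset (Line K)} {v : Fin 3 → K} :
    eval v (∏ l ∈ s, l.equation) = 0 ↔ ∃ l ∈ s, eval v l.equation = 0 := by
  rw [map_prod, Finset.prod_eq_zero_iff]

/-! ### The triangle -/

/-- The lines `x`, `y`, `z` are the sides of the triangle `A B C`, opposite to `A`, `B`, `C`. -/
structure IsTriangle (A B C : Plane K) (x y z : Line K) : Prop where
  not_A_x : ¬ OnLine A x
  not_B_y : ¬ OnLine B y
  not_C_z : ¬ OnLine C z
  A_y : OnLine A y
  A_z : OnLine A z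
  B_z : OnLine B z
  B_x : OnLine B x
  C_x : OnLine C x
  C_y : OnLine C y

theorem exists_isTriangle {A B C : Plane K}
    (hABC : Projectivization.Independent (K := K) (V := Fin 3 → K) ![A, B, C]) :
    ∃ x y z : Line K, IsTriangle A B C x y z := by
  have hli := Projectivization.independent_iff.mp hABC
  have hne : ∀ i j : Fin 3, i ≠ j → (![A, B, C] : Fin 3 → Plane K) i ≠ ![A, B, C] j := by
    intro i j hij h
    exact hij (hli.injective (congrArg Projectivization.rep h))
  have hcol : ∀ l : Line K, OnLine A l → OnLine B l → OnLine C l → False := by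
    intro l hA hB hC
    let M : Matrix (Fin 3) (Fin 3) K := Matrix.of (Projectivization.rep ∘ ![A, B, C])
    have hM : IsUnit M := Matrix.linearIndependent_rows_iff_isUnit.mp hli
    refine l.rep_nonzero (Matrix.eq_zero_of_mulVec_eq_zero
      ((Matrix.isUnit_iff_isUnit_det M).mp hM).ne_zero (_root_.funext fun i => ?_))
    rw [onLine_iff, dotProduct_comm] at hA hB hC
    fin_cases i
    exacts [hA, hB, hC]
  obtain ⟨x, h1, h2⟩ := exists_line_through (hne 1 2 (by decide))
  obtain ⟨y, h3, h4⟩ := exists_line_through (hne 2 0 (by decide))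
  obtain ⟨z, h5, h6⟩ := exists_line_through (hne 0 1 (by decide))
  exact ⟨x, y, z, fun h => hcol x h h1 h2, fun h => hcol y h4 h h3, fun h => hcol z h5 h6 h,
    h4, h5, h6, h1, h2, h3⟩

namespace IsTriangle

variable {A B C : Plane K} {x y z : Line K}

theorem rotate (h : IsTriangle A B C x y z) : IsTriangle B C A y z x :=
  ⟨h.not_B_y, h.not_C_z, h.not_A_x, h.B_z, h.B_x, h.C_x, h.C_y, h.A_y, h.A_z⟩

theorem y_ne_z (h : IsTriangle A B C x y z) : y ≠ z := fun e => h.not_B_y (e ▸ h.B_z)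

theorem A_ne_B (h : IsTriangle A B C x y z) : A ≠ B := fun e => h.not_A_x (e ▸ h.B_x)

theorem linearIndependent (h : IsTriangle A B C x y z) :
    LinearIndependent K ![x.rep, y.rep, z.rep] := by
  refine Fintype.linearIndependent_iff.mpr fun g hg => ?_
  have key : ∀ P : Plane K, g 0 * (x.rep ⬝ᵥ Projectivization.rep P) +
      g 1 * (y.rep ⬝ᵥ Projectivization.rep P) + g 2 * (z.rep ⬝ᵥ Projectivization.rep P) = 0 := by
    intro P
    have := congrArg (· ⬝ᵥ Projectivization.rep P) hg
    simpa [Fin.sum_univ_three, add_dotProduct] using this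
  have hA := key A
  have hB := key B
  have hC := key C
  rw [onLine_iff.mp h.A_y, onLine_iff.mp h.A_z] at hA
  rw [onLine_iff.mp h.B_x, onLine_iff.mp h.B_z] at hB
  rw [onLine_iff.mp h.C_x, onLine_iff.mp h.C_y] at hC
  simp only [mul_zero, add_zero, zero_add] at hA hB hC
  intro i
  fin_cases i
  · exact (mul_eq_zero.mp hA).resolve_right fun e => h.not_A_x (onLine_iff.mpr e)
  · exact (mul_eq_zero.mp hB).resolve_right fun e => h.not_B_y (onLine_iff.mpr e)
  · exact (mul_eq_zero.mp hC).resolve_right fun e => h.not_C_z (onLine_iff.mpr e)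

/-- The equation of a line through `A` other than the two sides through `A` is a combination, with
nonzero coefficients, of the equations of these sides. -/
theorem rep_eq (h : IsTriangle A B C x y z) {l : Line K} (hl : OnLine A l) (hy : l ≠ y)
    (hz : l ≠ z) : ∃ r s : K, r ≠ 0 ∧ s ≠ 0 ∧ l.rep = r • y.rep + s • z.rep := by
  have hspan := h.linearIndependent.span_eq_top_of_card_eq_finrank' (by simp)
  obtain ⟨g, hg⟩ := (Submodule.mem_span_range_iff_exists_fun K).mp
    (hspan ▸ Submodule.mem_top : l.rep ∈ Submodule.span K (Set.range ![x.rep, y.rep, z.rep]))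
  simp only [Fin.sum_univ_three, Matrix.cons_val_zero, Matrix.cons_val_one, Matrix.cons_val] at hg
  have h0 : g 0 = 0 := by
    have h1 := onLine_iff.mp hl
    rw [← hg, add_dotProduct, add_dotProduct, smul_dotProduct, smul_dotProduct, smul_dotProduct,
      onLine_iff.mp h.A_y, onLine_iff.mp h.A_z] at h1
    simp only [smul_eq_mul, mul_zero, add_zero] at h1
    exact (mul_eq_zero.mp h1).resolve_right fun e => h.not_A_x (onLine_iff.mpr e)
  rw [h0, zero_smul, zero_add] at hg
  have hmk : ∀ (m : Line K) (r : K), r • m.rep = l.rep → l = m := by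
    intro m r hr
    rw [← l.mk_rep, ← m.mk_rep, Projectivization.mk_eq_mk_iff']
    exact ⟨r, hr⟩
  refine ⟨g 1, g 2, fun e => hz (hmk z (g 2) ?_), fun e => hy (hmk y (g 1) ?_), hg.symm⟩
  · rw [← hg, e, zero_smul, zero_add]
  · rw [← hg, e, zero_smul, add_zero]

end IsTriangle

namespace TriangleData

variable {T : TriangleData K} {A B C : Plane K}

theorem rotate_lines : T.rotate.lines = T.lines := by
  ext l
  simp only [mem_lines]
  change (l = T.y ∨ l = T.z ∨ l = T.x ∨ l ∈ T.fB ∨ l ∈ T.fC ∨ l ∈ T.fA) ↔ _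
  tauto

theorem dotProduct_of_mem_fA {l : Line K} {r s : K}
    (h : l.rep = r • T.y.rep + s • T.z.rep) (v : Fin 3 → K) :
    l.rep ⬝ᵥ v = r * (T.y.rep ⬝ᵥ v) + s * (T.z.rep ⬝ᵥ v) := by
  rw [h, add_dotProduct, smul_dotProduct, smul_dotProduct, smul_eq_mul, smul_eq_mul]

theorem incidence_of_mem_fA (h : IsTriangle A B C T.x T.y T.z) {l : Line K} (hl : l ∈ T.fA) :
    OnLine A l ∧ ¬ OnLine B l ∧ ¬ OnLine C l := by
  obtain ⟨r, s, hr, hs, hrs⟩ := T.rep_fA l hl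
  refine ⟨?_, ?_, ?_⟩
  · rw [onLine_iff, dotProduct_of_mem_fA hrs, onLine_iff.mp h.A_y, onLine_iff.mp h.A_z]
    simp
  · rw [onLine_iff, dotProduct_of_mem_fA hrs, onLine_iff.mp h.B_z, mul_zero, add_zero]
    exact mul_ne_zero hr fun e => h.not_B_y (onLine_iff.mpr e)
  · rw [onLine_iff, dotProduct_of_mem_fA hrs, onLine_iff.mp h.C_y, mul_zero, zero_add]
    exact mul_ne_zero hs fun e => h.not_C_z (onLine_iff.mpr e)

theorem incidence_of_mem_fB (h : IsTriangle A B C T.x T.y T.z) {l : Line K} (hl : l ∈ T.fB) :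
    OnLine B l ∧ ¬ OnLine C l ∧ ¬ OnLine A l :=
  incidence_of_mem_fA (T := T.rotate) h.rotate hl

theorem incidence_of_mem_fC (h : IsTriangle A B C T.x T.y T.z) {l : Line K} (hl : l ∈ T.fC) :
    OnLine C l ∧ ¬ OnLine A l ∧ ¬ OnLine B l :=
  incidence_of_mem_fB (T := T.rotate) h.rotate hl

/-- The lines of the arrangement through the first vertex. -/
theorem mem_lines_and_onLine_iff (h : IsTriangle A B C T.x T.y T.z) {l : Line K} :
    l ∈ T.lines ∧ OnLine A l ↔ l = T.y ∨ l = T.z ∨ l ∈ T.fA := by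
  rw [mem_lines]
  constructor
  · rintro ⟨rfl | rfl | rfl | hl | hl | hl, hA⟩
    · exact absurd hA h.not_A_x
    · exact Or.inl rfl
    · exact Or.inr (Or.inl rfl)
    · exact Or.inr (Or.inr hl)
    · exact absurd hA (incidence_of_mem_fB h hl).2.2
    · exact absurd hA (incidence_of_mem_fC h hl).2.1
  · rintro (rfl | rfl | hl)
    · exact ⟨by simp, h.A_y⟩
    · exact ⟨by simp, h.A_z⟩
    · exact ⟨by simp [hl], (incidence_of_mem_fA h hl).1⟩

theorem multiplicity_A (h : IsTriangle A B C T.x T.y T.z) :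
    multiplicity T.lines A = T.fA.card + 2 := by
  classical
  have e : {l | l ∈ T.lines ∧ OnLine A l} = ↑(insert T.y (insert T.z T.fA)) := by
    ext l
    have := mem_lines_and_onLine_iff (l := l) h
    simpa using this
  have hz : T.z ∉ T.fA := fun hz => (incidence_of_mem_fA h hz).2.1 h.B_z
  have hy : T.y ∉ insert T.z T.fA := by
    rw [Finset.mem_insert]
    rintro (hy | hy)
    · exact h.y_ne_z hy
    · exact (incidence_of_mem_fA h hy).2.2 h.C_y
  rw [multiplicity, e, Set.ncard_coe_finset, Finset.card_insert_of_notMem hy,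
    Finset.card_insert_of_notMem hz]

theorem lines_mem_Tr (h : IsTriangle A B C T.x T.y T.z) :
    T.lines ∈ Tr A B C (T.fA.card + 1) (T.fB.card + 1) (T.fC.card + 1) := by
  refine ⟨fun l hl => ?_, fun l hl => ?_, multiplicity_A h, ?_, ?_⟩
  · rcases T.mem_lines.mp hl with rfl | rfl | rfl | hl | hl | hl
    · exact Or.inr (Or.inl h.B_x)
    · exact Or.inl h.A_y
    · exact Or.inl h.A_z
    · exact Or.inl (incidence_of_mem_fA h hl).1
    · exact Or.inr (Or.inl (incidence_of_mem_fB h hl).1)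
    · exact Or.inr (Or.inr (incidence_of_mem_fC h hl).1)
  · rw [mem_lines]
    rcases hl with ⟨h1, h2⟩ | ⟨h1, h2⟩ | ⟨h1, h2⟩
    · exact Or.inr (Or.inr (Or.inl (line_unique h.A_ne_B h1 h2 h.A_z h.B_z)))
    · exact Or.inr (Or.inl (line_unique h.rotate.rotate.A_ne_B h2 h1 h.C_y h.A_y))
    · exact Or.inl (line_unique h.rotate.A_ne_B h1 h2 h.B_x h.C_x)
  · rw [← rotate_lines]
    exact multiplicity_A (T := T.rotate) h.rotate
  · rw [← rotate_lines, ← rotate_lines]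
    exact multiplicity_A (T := T.rotate.rotate) h.rotate.rotate

end TriangleData

/-- Every arrangement in `Tr A B C a b c` comes from a `TriangleData`. -/
theorem exists_triangleData {A B C : Plane K} {x y z : Line K} (h : IsTriangle A B C x y z)
    {a b c : ℕ} {𝒜 : Finset (Line K)} (h𝒜 : 𝒜 ∈ Tr A B C a b c) :
    ∃ T : TriangleData K, IsTriangle A B C T.x T.y T.z ∧ T.lines = 𝒜 ∧
      a = T.fA.card + 1 ∧ b = T.fB.card + 1 ∧ c = T.fC.card + 1 := by
  classical
  obtain ⟨h1, h2, hA, hB, hC⟩ := h𝒜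
  let T : TriangleData K :=
    { x := x
      y := y
      z := z
      linearIndependent := h.linearIndependent
      fA := {l ∈ 𝒜 | OnLine A l ∧ l ≠ y ∧ l ≠ z}
      fB := {l ∈ 𝒜 | OnLine B l ∧ l ≠ z ∧ l ≠ x}
      fC := {l ∈ 𝒜 | OnLine C l ∧ l ≠ x ∧ l ≠ y}
      rep_fA := fun l hl => by
        rw [Finset.mem_filter] at hl
        exact h.rep_eq hl.2.1 hl.2.2.1 hl.2.2.2
      rep_fB := fun l hl => by
        rw [Finset.mem_filter] at hl
        exact h.rotate.rep_eq hl.2.1 hl.2.2.1 hl.2.2.2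
      rep_fC := fun l hl => by
        rw [Finset.mem_filter] at hl
        exact h.rotate.rotate.rep_eq hl.2.1 hl.2.2.1 hl.2.2.2 }
  have hx : x ∈ 𝒜 := h2 x (Or.inr (Or.inr ⟨h.B_x, h.C_x⟩))
  have hy : y ∈ 𝒜 := h2 y (Or.inr (Or.inl ⟨h.A_y, h.C_y⟩))
  have hz : z ∈ 𝒜 := h2 z (Or.inl ⟨h.A_z, h.B_z⟩)
  have hT : IsTriangle A B C T.x T.y T.z := h
  have hlines : T.lines = 𝒜 := by
    ext l
    rw [T.mem_lines]
    change (l = x ∨ l = y ∨ l = z ∨ l ∈ {l ∈ 𝒜 | OnLine A l ∧ l ≠ y ∧ l ≠ z} ∨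
      l ∈ {l ∈ 𝒜 | OnLine B l ∧ l ≠ z ∧ l ≠ x} ∨ l ∈ {l ∈ 𝒜 | OnLine C l ∧ l ≠ x ∧ l ≠ y}) ↔ _
    simp only [Finset.mem_filter]
    constructor
    · rintro (rfl | rfl | rfl | hl | hl | hl)
      exacts [hx, hy, hz, hl.1, hl.1, hl.1]
    · intro hl
      have := h1 l hl
      tauto
  obtain ⟨-, -, hA', hB', hC'⟩ := TriangleData.lines_mem_Tr hT
  rw [hlines] at hA' hB' hC'
  exact ⟨T, hT, hlines, by omega, by omega, by omega⟩

namespace TriangleData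

variable {T : TriangleData K} {A B C : Plane K}

/-! ### The inner triple points -/

theorem mem_fA_of_mem_lines (h : IsTriangle A B C T.x T.y T.z) {p : Plane K} (hpB : p ≠ B)
    (hpC : p ≠ C) {l m n : Line K} (hl : l ∈ T.lines) (hlm : l ≠ m) (hln : l ≠ n)
    (hpl : OnLine p l) (hpm : OnLine p m) (hpn : OnLine p n) (hAl : OnLine A l)
    (hBm : OnLine B m) (hCn : OnLine C n) : l ∈ T.fA := by
  rcases (mem_lines_and_onLine_iff h).mp ⟨hl, hAl⟩ with rfl | rfl | hl
  · exact absurd (point_unique hln hpl hpn h.C_y hCn) hpC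
  · exact absurd (point_unique hlm hpl hpm h.B_z hBm) hpB
  · exact hl

theorem exists_of_vertices (h : IsTriangle A B C T.x T.y T.z) {p : Plane K} (hpA : p ≠ A)
    (hpB : p ≠ B) (hpC : p ≠ C) {l m n : Line K} (hl : l ∈ T.lines) (hm : m ∈ T.lines)
    (hn : n ∈ T.lines) (hlm : l ≠ m) (hln : l ≠ n) (hmn : m ≠ n)
    (hpl : OnLine p l) (hpm : OnLine p m) (hpn : OnLine p n) (hAl : OnLine A l)
    (hBm : OnLine B m) (hCn : OnLine C n) :
    ∃ l ∈ T.fA, ∃ m ∈ T.fB, ∃ n ∈ T.fC, OnLine p l ∧ OnLine p m ∧ OnLine p n :=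
  ⟨l, mem_fA_of_mem_lines h hpB hpC hl hlm hln hpl hpm hpn hAl hBm hCn,
    m, mem_fA_of_mem_lines (T := T.rotate) h.rotate hpC hpA (by rwa [rotate_lines]) hmn hlm.symm
      hpm hpn hpl hBm hCn hAl,
    n, mem_fA_of_mem_lines (T := T.rotate.rotate) h.rotate.rotate hpA hpB
      (by rwa [rotate_lines, rotate_lines]) hln.symm hmn.symm hpn hpl hpm hCn hAl hBm,
    hpl, hpm, hpn⟩

/-- The inner triple points are the points in which inner lines through the three vertices
meet. -/
theorem mem_innerTriplePoints_iff (h : IsTriangle A B C T.x T.y T.z) {p : Plane K} :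
    p ∈ innerTriplePoints A B C T.lines ↔
      ∃ l ∈ T.fA, ∃ m ∈ T.fB, ∃ n ∈ T.fC, OnLine p l ∧ OnLine p m ∧ OnLine p n := by
  have hvert := (lines_mem_Tr h).1
  constructor
  · rintro ⟨hpA, hpB, hpC, hp⟩
    obtain ⟨l, m, n, hlm, hln, hmn, e⟩ := Set.ncard_eq_three.mp hp
    have hmem : ∀ k, k = l ∨ k = m ∨ k = n → k ∈ T.lines ∧ OnLine p k := by
      intro k hk
      have : k ∈ ({l, m, n} : Set (Line K)) := by simpa using hk
      rwa [← e] at this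
    obtain ⟨hl, hpl⟩ := hmem l (by simp)
    obtain ⟨hm, hpm⟩ := hmem m (by simp)
    obtain ⟨hn, hpn⟩ := hmem n (by simp)
    have huniq : ∀ {P : Plane K} {k k' : Line K}, p ≠ P → k ≠ k' → OnLine p k → OnLine p k' →
        OnLine P k → OnLine P k' → False := fun hP hk h1 h2 h3 h4 =>
      hP (point_unique hk h1 h2 h3 h4)
    rcases hvert l hl with h1 | h1 | h1 <;> rcases hvert m hm with h2 | h2 | h2 <;>
      rcases hvert n hn with h3 | h3 | h3
    all_goals
      first
      | exact (huniq (by assumption) hlm hpl hpm h1 h2).elim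
      | exact (huniq (by assumption) hln hpl hpn h1 h3).elim
      | exact (huniq (by assumption) hmn hpm hpn h2 h3).elim
      | exact exists_of_vertices h hpA hpB hpC hl hm hn hlm hln hmn hpl hpm hpn h1 h2 h3
      | exact exists_of_vertices h hpA hpB hpC hl hn hm hln hlm hmn.symm hpl hpn hpm h1 h3 h2
      | exact exists_of_vertices h hpA hpB hpC hm hl hn hlm.symm hmn hln hpm hpl hpn h2 h1 h3
      | exact exists_of_vertices h hpA hpB hpC hm hn hl hmn hlm.symm hln.symm hpm hpn hpl h2 h3 h1
      | exact exists_of_vertices h hpA hpB hpC hn hl hm hln.symm hmn.symm hlm hpn hpl hpm h3 h1 h2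
      | exact exists_of_vertices h hpA hpB hpC hn hm hl hmn.symm hln.symm hlm.symm hpn hpm hpl
          h3 h2 h1
  · rintro ⟨l, hl, m, hm, n, hn, hpl, hpm, hpn⟩
    obtain ⟨hAl, hBl, hCl⟩ := incidence_of_mem_fA h hl
    obtain ⟨hBm, hCm, hAm⟩ := incidence_of_mem_fB h hm
    obtain ⟨hCn, hAn, hBn⟩ := incidence_of_mem_fC h hn
    have hpA : p ≠ A := by rintro rfl; exact hAm hpm
    have hpB : p ≠ B := by rintro rfl; exact hBl hpl
    have hpC : p ≠ C := by rintro rfl; exact hCl hpl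
    refine ⟨hpA, hpB, hpC, Set.ncard_eq_three.mpr ⟨l, m, n, ?_, ?_, ?_, ?_⟩⟩
    · rintro rfl; exact hAm hAl
    · rintro rfl; exact hAn hAl
    · rintro rfl; exact hBn hBm
    · ext k
      simp only [Set.mem_insert_iff, Set.mem_singleton_iff]
      constructor
      · rintro ⟨hk, hpk⟩
        rcases hvert k hk with h1 | h1 | h1
        · exact Or.inl (line_unique hpA hpk h1 hpl hAl)
        · exact Or.inr (Or.inl (line_unique hpB hpk h1 hpm hBm))
        · exact Or.inr (Or.inr (line_unique hpC hpk h1 hpn hCn))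
      · rintro (rfl | rfl | rfl)
        · exact ⟨by simp [mem_lines, hl], hpl⟩
        · exact ⟨by simp [mem_lines, hm], hpm⟩
        · exact ⟨by simp [mem_lines, hn], hpn⟩

theorem ne_of_mem_fA_of_mem_fB {l m : Line K} (hl : l ∈ T.fA) (hm : m ∈ T.fB) : l ≠ m :=
  fun e => T.notMem_fB_of_mem_fA hl (e ▸ hm)

theorem encard_innerTriplePoints_le (h : IsTriangle A B C T.x T.y T.z) :
    (innerTriplePoints A B C T.lines).encard ≤ (T.fA.card * T.fB.card : ℕ) := by
  classical
  let cr : Line K × Line K → Plane K := fun lm => Projectivization.cross lm.1 lm.2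
  have hsub : innerTriplePoints A B C T.lines ⊆ ((T.fA ×ˢ T.fB).image cr : Finset (Plane K)) := by
    intro p hp
    obtain ⟨l, hl, m, hm, n, hn, hpl, hpm, hpn⟩ := (mem_innerTriplePoints_iff h).mp hp
    have hlm := ne_of_mem_fA_of_mem_fB hl hm
    simp only [Finset.coe_image, Set.mem_image, Finset.mem_coe, Finset.mem_product]
    exact ⟨(l, m), ⟨hl, hm⟩, point_unique hlm (Projectivization.orthogonal_cross_left hlm)
      (Projectivization.orthogonal_cross_right hlm) hpl hpm⟩
  refine (Set.encard_le_encard hsub).trans ?_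
  rw [Set.encard_coe_eq_coe_finsetCard]
  exact_mod_cast Finset.card_image_le.trans (Finset.card_product _ _).le

/-- A polynomial that vanishes on the punctured cone over the full grid of the intersection
points of the inner lines through the first two vertices belongs to the ideal `(F, G)`. -/
theorem mem_span_F_G [Infinite K] (h : IsTriangle A B C T.x T.y T.z) {q : MvPolynomial (Fin 3) K}
    (hq : ∀ l ∈ T.fA, ∀ m ∈ T.fB, ∀ p : Plane K, OnLine p l → OnLine p m →
      ∀ t : K, t ≠ 0 → eval (t • Projectivization.rep p) q = 0) :
    q ∈ Ideal.span {T.F, T.G} := by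
  have hnot : ∀ l ∈ T.fA, ∀ m ∈ T.fB, ∀ (k : Line K) (P : Plane K), OnLine P k →
      (OnLine P l ∧ l ≠ k ∧ ¬ OnLine P m ∨ OnLine P m ∧ m ≠ k ∧ ¬ OnLine P l) →
      k.equation ∉ Ideal.span {l.equation, m.equation} := by
    intro l hl m hm k P hPk hP hmem
    obtain ⟨p, hpl, hpm⟩ := exists_onLine_onLine (ne_of_mem_fA_of_mem_fB hl hm)
    have hpk : OnLine p k := onLine_iff_eval.mpr
      (eval_eq_zero_of_mem_span (onLine_iff_eval.mp hpl) (onLine_iff_eval.mp hpm) hmem)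
    rcases hP with ⟨h1, h2, h3⟩ | ⟨h1, h2, h3⟩
    · exact h3 (point_unique h2 hpl hpk h1 hPk ▸ hpm)
    · exact h3 (point_unique h2 hpm hpk h1 hPk ▸ hpl)
  refine mem_span_prod_prod (f := Line.equation) (g := Line.equation) ?_ ?_ ?_ ?_
  · exact fun l hl m hm => isPrime_span_equation (ne_of_mem_fA_of_mem_fB hl hm)
  · exact fun l hl m hm k hk hkl => hnot l hl m hm k A (incidence_of_mem_fA h hk).1
      (Or.inl ⟨(incidence_of_mem_fA h hl).1, hkl.symm, (incidence_of_mem_fB h hm).2.2⟩)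
  · exact fun l hl m hm k hk hkm => hnot l hl m hm k B (incidence_of_mem_fB h hk).1
      (Or.inr ⟨(incidence_of_mem_fB h hm).1, hkm.symm, (incidence_of_mem_fA h hl).2.1⟩)
  · intro l hl m hm
    have hlm := ne_of_mem_fA_of_mem_fB hl hm
    obtain ⟨p, hpl, hpm⟩ := exists_onLine_onLine hlm
    exact mem_span_equation hlm hpl hpm (hq l hl m hm p hpl hpm)

theorem eval_smul_H_eq_zero {n : Line K} (hn : n ∈ T.fC) {p : Plane K} (hp : OnLine p n) (t : K) :
    eval (t • Projectivization.rep p) T.H = 0 := by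
  rw [eval_smul_of_isHomogeneous (isForm_natCast.mp T.isForm_H), H,
    eval_prod_equation_eq_zero_iff.mpr ⟨n, hn, onLine_iff_eval.mp hp⟩, mul_zero]

/-- If every point of the grid lies on an inner line through the third vertex, then `H` lies in
the ideal of the grid. -/
theorem H_mem_of_forall_exists [Infinite K] (h : IsTriangle A B C T.x T.y T.z)
    (hfull : ∀ l ∈ T.fA, ∀ m ∈ T.fB, ∀ p : Plane K, OnLine p l → OnLine p m →
      ∃ n ∈ T.fC, OnLine p n) : T.H ∈ Ideal.span {T.F, T.G} :=
  mem_span_F_G h fun l hl m hm p hpl hpm t _ => by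
    obtain ⟨n, hn, hpn⟩ := hfull l hl m hm p hpl hpm
    exact eval_smul_H_eq_zero hn hpn t

theorem prod_equation_mem_vanishingIdeal {S : Set (Plane K)} {s : Finset (Line K)}
    (hs : ∀ p ∈ S, ∃ l ∈ s, OnLine p l) :
    ∏ l ∈ s, l.equation ∈ vanishingIdeal K (cone S) := by
  rw [mem_vanishingIdeal_iff]
  rintro v ⟨hv, hvS⟩
  obtain ⟨l, hl, hvl⟩ := hs _ hvS
  rw [aeval_eq_eval]
  exact eval_prod_equation_eq_zero_iff.mpr ⟨l, hl, (onLine_mk_iff hv).mp hvl⟩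

/-- If the ideal of the inner triple points is generated by forms of the degrees of `F` and `G`,
then it is `(F, G)`, and it contains `H`. -/
theorem H_mem_of_isCompleteIntersection (h : IsTriangle A B C T.x T.y T.z)
    (hCI : IsCompleteIntersection (innerTriplePoints A B C T.lines) T.fA.card T.fB.card) :
    T.H ∈ Ideal.span {T.F, T.G} := by
  obtain ⟨P, Q, hP, hQ, hI⟩ := hCI
  rcases T.fA.eq_empty_or_nonempty with hA | hA
  · rw [F, hA, Finset.prod_empty]
    exact Ideal.mem_span_pair.mpr ⟨T.H, 0, by ring⟩
  rcases T.fB.eq_empty_or_nonempty with hB | hB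
  · rw [G, hB, Finset.prod_empty]
    exact Ideal.mem_span_pair.mpr ⟨0, T.H, by ring⟩
  have hA0 := hA.card_pos
  have hB0 := hB.card_pos
  have hF : T.F ∈ Ideal.span {P, Q} := hI ▸ prod_equation_mem_vanishingIdeal fun p hp => by
    obtain ⟨l, hl, m, hm, n, hn, hpl, hpm, hpn⟩ := (mem_innerTriplePoints_iff h).mp hp
    exact ⟨l, hl, hpl⟩
  have hG : T.G ∈ Ideal.span {P, Q} := hI ▸ prod_equation_mem_vanishingIdeal fun p hp => by
    obtain ⟨l, hl, m, hm, n, hn, hpl, hpm, hpn⟩ := (mem_innerTriplePoints_iff h).mp hp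
    exact ⟨m, hm, hpm⟩
  have hH : T.H ∈ Ideal.span {P, Q} := hI ▸ prod_equation_mem_vanishingIdeal fun p hp => by
    obtain ⟨l, hl, m, hm, n, hn, hpl, hpm, hpn⟩ := (mem_innerTriplePoints_iff h).mp hp
    exact ⟨n, hn, hpn⟩
  have hcomb : ∀ (d : ℤ) q, IsForm d q → q ∈ Ideal.span {P, Q} → ∃ s t,
      IsForm (d - T.fA.card) s ∧ IsForm (d - T.fB.card) t ∧ q = P * s + Q * t := by
    intro d q hq hmem
    obtain ⟨s, t, hst⟩ := Ideal.mem_span_pair.mp hmem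
    refine ⟨_, _, isForm_formComponent _ s, isForm_formComponent _ t, ?_⟩
    rw [← formComponent_mul (isForm_natCast.mpr hP), ← formComponent_mul (isForm_natCast.mpr hQ),
      ← map_add, mul_comm P, mul_comm Q, hst, hq.formComponent_eq]
  obtain ⟨s, t, hs, ht, e1⟩ := hcomb _ _ T.isForm_F hF
  obtain ⟨s', t', hs', ht', e2⟩ := hcomb _ _ T.isForm_G hG
  -- the determinant of the transition matrix is a constant
  have hΔ : IsForm 0 (s * t' - t * s') :=
    ((hs.mul ht').congr (by ring)).sub ((ht.mul hs').congr (by ring))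
  have hP' : (s * t' - t * s') * P = t' * T.F - t * T.G := by rw [e1, e2]; ring
  have hQ' : (s * t' - t * s') * Q = s * T.G - s' * T.F := by rw [e1, e2]; ring
  by_cases hr : coeff 0 (s * t' - t * s') = 0
  · -- a vanishing determinant gives two relations between the coprime forms `F` and `G` whose
    -- coefficients have too small degrees
    have h0 : s * t' - t * s' = 0 := by rw [hΔ.eq_C, hr, C_0]
    rw [h0, zero_mul] at hP' hQ'
    exfalso
    have ht0 : t = 0 := by
      obtain ⟨k, hk⟩ := T.isRelPrime_F_G.dvd_of_dvd_mul_right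
        (⟨t', by linear_combination hP'⟩ : T.F ∣ t * T.G)
      have hk' : IsForm (-T.fB.card : ℤ) k :=
        T.isForm_F.of_mul T.F_ne_zero (by rw [← hk]; exact ht.congr (by ring))
      rw [hk, hk'.eq_zero_of_neg (by omega), mul_zero]
    have hs0 : s = 0 := by
      have hs'0 : s' = 0 := by
        obtain ⟨k, hk⟩ := T.isRelPrime_F_G.symm.dvd_of_dvd_mul_right
          (⟨s, by linear_combination hQ'⟩ : T.G ∣ s' * T.F)
        have hk' : IsForm (-T.fA.card : ℤ) k :=
          T.isForm_G.of_mul T.G_ne_zero (by rw [← hk]; exact hs'.congr (by ring))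
        rw [hk, hk'.eq_zero_of_neg (by omega), mul_zero]
      rw [hs'0, zero_mul, sub_zero] at hQ'
      exact (mul_eq_zero.mp hQ'.symm).resolve_right T.G_ne_zero
    exact T.F_ne_zero (by rw [e1, hs0, ht0]; ring)
  · let r := coeff 0 (s * t' - t * s')
    replace hP' : MvPolynomial.C r * P = t' * T.F - t * T.G := hΔ.eq_C ▸ hP'
    replace hQ' : MvPolynomial.C r * Q = s * T.G - s' * T.F := hΔ.eq_C ▸ hQ'
    have hC : (MvPolynomial.C r⁻¹ * MvPolynomial.C r : MvPolynomial (Fin 3) K) = 1 := by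
      rw [← C_mul, inv_mul_cancel₀ hr, C_1]
    set e := (MvPolynomial.C r⁻¹ : MvPolynomial (Fin 3) K)
    refine Ideal.span_le.mpr ?_ hH
    rintro q (rfl | rfl)
    · exact Ideal.mem_span_pair.mpr ⟨e * t', -(e * t), by
        linear_combination (-e) * hP' + q * hC⟩
    · exact Ideal.mem_span_pair.mpr ⟨-(e * s'), e * s, by
        linear_combination (-e) * hQ' + q * hC⟩

/-- If `H ∈ (F, G)`, then every point of the grid is a triple point, and `(F, G)` is the ideal of
the triple points. -/
theorem isCompleteIntersection_of_H_mem [Infinite K] (h : IsTriangle A B C T.x T.y T.z)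
    (hH : T.H ∈ Ideal.span {T.F, T.G}) :
    IsCompleteIntersection (innerTriplePoints A B C T.lines) T.fA.card T.fB.card := by
  refine ⟨T.F, T.G, isForm_natCast.mp T.isForm_F, isForm_natCast.mp T.isForm_G,
    le_antisymm (fun q hq => ?_) (Ideal.span_le.mpr ?_)⟩
  · refine mem_span_F_G h fun l hl m hm p hpl hpm t ht => ?_
    have hpF : eval (Projectivization.rep p) T.F = 0 :=
      eval_prod_equation_eq_zero_iff.mpr ⟨l, hl, onLine_iff_eval.mp hpl⟩
    have hpG : eval (Projectivization.rep p) T.G = 0 :=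
      eval_prod_equation_eq_zero_iff.mpr ⟨m, hm, onLine_iff_eval.mp hpm⟩
    obtain ⟨n, hn, hpn⟩ :=
      eval_prod_equation_eq_zero_iff.mp (eval_eq_zero_of_mem_span hpF hpG hH)
    have hp : p ∈ innerTriplePoints A B C T.lines :=
      (mem_innerTriplePoints_iff h).mpr ⟨l, hl, m, hm, n, hn, hpl, hpm, onLine_iff_eval.mpr hpn⟩
    have hv : t • Projectivization.rep p ≠ 0 := smul_ne_zero ht (Projectivization.rep_nonzero p)
    have hmk : ∀ p : ℙ K (Fin 3 → K), ∀ hv : t • p.rep ≠ 0,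
        Projectivization.mk K (t • p.rep) hv = p := by
      intro p hv
      conv_rhs => rw [← p.mk_rep]
      exact (Projectivization.mk_eq_mk_iff' _ _ _ _ _).mpr ⟨t, rfl⟩
    have := mem_vanishingIdeal_iff.mp hq (t • Projectivization.rep p)
      ⟨hv, by rw [hmk p hv]; exact hp⟩
    rwa [aeval_eq_eval] at this
  · rintro q (rfl | rfl)
    · refine prod_equation_mem_vanishingIdeal fun p hp => ?_
      obtain ⟨l, hl, m, hm, n, hn, hpl, hpm, hpn⟩ := (mem_innerTriplePoints_iff h).mp hp
      exact ⟨l, hl, hpl⟩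
    · refine prod_equation_mem_vanishingIdeal fun p hp => ?_
      obtain ⟨l, hl, m, hm, n, hn, hpl, hpm, hpn⟩ := (mem_innerTriplePoints_iff h).mp hp
      exact ⟨m, hm, hpm⟩

end TriangleData

/-! ### Arrangements whose inner triple points form a full grid -/

theorem eq_zero_of_smul_rep_add_smul_rep {l m : Line K} (h : l ≠ m) {r s : K}
    (hrs : r • l.rep + s • m.rep = 0) : r = 0 ∧ s = 0 := by
  have hr : r = 0 := by
    by_contra hr
    apply h
    rw [← l.mk_rep, ← m.mk_rep, Projectivization.mk_eq_mk_iff']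
    refine ⟨-(r⁻¹ * s), ?_⟩
    have h1 := congrArg (r⁻¹ • ·) (eq_neg_of_add_eq_zero_left hrs)
    simp only [smul_smul, smul_neg, inv_mul_cancel₀ hr, one_smul] at h1
    rw [h1, neg_smul]
  rw [hr, zero_smul, zero_add] at hrs
  exact ⟨hr, (smul_eq_zero.mp hrs).resolve_right m.rep_nonzero⟩

/-- The lines `l = s m` of the pencil spanned by `l` and `m`, for `s` in the finite set `S`. -/
theorem exists_pencil {l m : Line K} (h : l ≠ m) (S : Finset K) :
    ∃ L : Finset (Line K), L.card = S.card ∧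
      (∀ k ∈ L, ∃ s ∈ S, ∃ u : K, u ≠ 0 ∧ k.rep = u • l.rep + (-(u * s)) • m.rep) ∧
      ∀ s ∈ S, ∃ k ∈ L, ∃ u : K, k.rep = u • l.rep + (-(u * s)) • m.rep := by
  classical
  have hne : ∀ s : K, l.rep + (-s) • m.rep ≠ 0 := fun s h0 =>
    one_ne_zero (eq_zero_of_smul_rep_add_smul_rep h (r := 1) (s := -s) (by rwa [one_smul])).1
  let φ : K → Line K := fun s => Projectivization.mk K _ (hne s)
  have hφ : ∀ s, ∃ u : K, u ≠ 0 ∧ (φ s).rep = u • l.rep + (-(u * s)) • m.rep := by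
    intro s
    obtain ⟨u, hu⟩ := Projectivization.exists_smul_eq_mk_rep K _ (hne s)
    refine ⟨u, u.ne_zero, ?_⟩
    rw [← hu, Units.smul_def]
    module
  have hinj : Function.Injective φ := by
    intro s t hst
    obtain ⟨a, ha⟩ := (Projectivization.mk_eq_mk_iff' _ _ _ _ _).mp hst
    obtain ⟨h1, h2⟩ := eq_zero_of_smul_rep_add_smul_rep h (r := a - 1) (s := s - a * t) (by
      calc (a - 1) • l.rep + (s - a * t) • m.rep
          = a • (l.rep + (-t) • m.rep) - (l.rep + (-s) • m.rep) := by module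
        _ = 0 := by rw [ha, sub_self])
    rw [sub_eq_zero.mp h1] at h2
    linear_combination h2
  refine ⟨S.image φ, Finset.card_image_of_injective _ hinj, fun k hk => ?_, fun s hs => ?_⟩
  · obtain ⟨s, hs, rfl⟩ := Finset.mem_image.mp hk
    exact ⟨s, hs, hφ s⟩
  · obtain ⟨u, -, hu⟩ := hφ s
    exact ⟨φ s, Finset.mem_image_of_mem _ hs, u, hu⟩

/-- The `N`-th roots of unity, for `N` possibly zero. -/
theorem exists_finset_mul_inv_mem [IsAlgClosed K] [CharZero K] (N : ℕ) :
    ∃ M : Finset K, M.card = N ∧ 0 ∉ M ∧ ∀ s ∈ M, ∀ t ∈ M, (s * t)⁻¹ ∈ M := by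
  rcases Nat.eq_zero_or_pos N with rfl | hN
  · exact ⟨∅, by simp⟩
  have : NeZero N := ⟨hN.ne'⟩
  have : NeZero (N : K) := ⟨by exact_mod_cast hN.ne'⟩
  obtain ⟨ζ, hζ⟩ := HasEnoughRootsOfUnity.exists_primitiveRoot K N
  refine ⟨Polynomial.nthRootsFinset N (1 : K), hζ.card_nthRootsFinset, ?_, ?_⟩
  · rw [Polynomial.mem_nthRootsFinset hN, zero_pow hN.ne']
    exact zero_ne_one
  · intro s hs t ht
    rw [Polynomial.mem_nthRootsFinset hN] at hs ht ⊢
    rw [inv_pow, mul_pow, hs, ht, one_mul, inv_one]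

/-- If `a, b ≤ c`, some arrangement with `a`, `b`, `c` inner lines through the vertices has a full
grid of inner triple points. With `N = max a b`, take lines `y = s z` through `A` and `z = t x`
through `B` for `N`-th roots of unity `s` and `t`, and through `C` the lines `x = r y` for all the
`N`-th roots of unity `r`, and further ones if `N < c`: the first two lines meet the third one
for `r = (s t)⁻¹` in a single point. -/
theorem exists_triangleData_H_mem [IsAlgClosed K] [CharZero K] {A B C : Plane K} {x y z : Line K}
    (h : IsTriangle A B C x y z) {a b c : ℕ} (hac : a ≤ c) (hbc : b ≤ c) :
    ∃ T : TriangleData K, IsTriangle A B C T.x T.y T.z ∧ T.fA.card = a ∧ T.fB.card = b ∧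
      T.fC.card = c ∧ T.H ∈ Ideal.span {T.F, T.G} := by
  classical
  have : Infinite K := inferInstance
  obtain ⟨M, hM, hM0, hMinv⟩ := exists_finset_mul_inv_mem (K := K) (max a b)
  obtain ⟨S, hSM, hS⟩ := Finset.exists_subset_card_eq (s := M) (n := a) (by omega)
  obtain ⟨S', hSM', hS'⟩ := Finset.exists_subset_card_eq (s := M) (n := b) (by omega)
  obtain ⟨R, hMR, hR, hR0⟩ : ∃ R : Finset K, M ⊆ R ∧ R.card = c ∧ 0 ∉ R := by
    obtain ⟨R, hMR, hR⟩ := Infinite.exists_superset_card_eq (insert 0 M) (c + 1) (by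
      rw [Finset.card_insert_of_notMem hM0]
      omega)
    refine ⟨R.erase 0, fun s hs => Finset.mem_erase.mpr ⟨fun e => hM0 (e ▸ hs),
      hMR (Finset.mem_insert_of_mem hs)⟩, ?_, Finset.notMem_erase _ _⟩
    rw [Finset.card_erase_of_mem (hMR (Finset.mem_insert_self _ _)), hR]
    omega
  obtain ⟨LA, hLA, hA, -⟩ := exists_pencil h.y_ne_z S
  obtain ⟨LB, hLB, hB, -⟩ := exists_pencil h.rotate.y_ne_z S'
  obtain ⟨LC, hLC, hC, hC'⟩ := exists_pencil h.rotate.rotate.y_ne_z R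
  have hcoef : ∀ s u : K, s ≠ 0 → u ≠ 0 → -(u * s) ≠ 0 := fun s u hs hu =>
    neg_ne_zero.mpr (mul_ne_zero hu hs)
  let T : TriangleData K :=
    { x := x
      y := y
      z := z
      linearIndependent := h.linearIndependent
      fA := LA
      fB := LB
      fC := LC
      rep_fA := fun k hk => by
        obtain ⟨s, hs, u, hu, e⟩ := hA k hk
        exact ⟨u, _, hu, hcoef s u (fun e => hM0 (e ▸ hSM hs)) hu, e⟩
      rep_fB := fun k hk => by
        obtain ⟨s, hs, u, hu, e⟩ := hB k hk
        exact ⟨u, _, hu, hcoef s u (fun e => hM0 (e ▸ hSM' hs)) hu, e⟩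
      rep_fC := fun k hk => by
        obtain ⟨s, hs, u, hu, e⟩ := hC k hk
        exact ⟨u, _, hu, hcoef s u (fun e => hR0 (e ▸ hs)) hu, e⟩ }
  have hT : IsTriangle A B C T.x T.y T.z := h
  refine ⟨T, hT, hLA.trans hS, hLB.trans hS', hLC.trans hR,
    TriangleData.H_mem_of_forall_exists hT fun l hl m hm p hpl hpm => ?_⟩
  obtain ⟨s, hs, u, hu, el⟩ := hA l hl
  obtain ⟨t, ht, v, hv, em⟩ := hB m hm
  obtain ⟨n, hn, w, en⟩ := hC' (s * t)⁻¹ (hMR (hMinv s (hSM hs) t (hSM' ht)))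
  refine ⟨n, hn, ?_⟩
  have hs0 : s ≠ 0 := fun e => hM0 (e ▸ hSM hs)
  have ht0 : t ≠ 0 := fun e => hM0 (e ▸ hSM' ht)
  rw [onLine_iff] at hpl hpm ⊢
  rw [el, add_dotProduct, smul_dotProduct, smul_dotProduct, smul_eq_mul, smul_eq_mul] at hpl
  rw [em, add_dotProduct, smul_dotProduct, smul_dotProduct, smul_eq_mul, smul_eq_mul] at hpm
  rw [en, add_dotProduct, smul_dotProduct, smul_dotProduct, smul_eq_mul, smul_eq_mul]
  have e1 : y.rep ⬝ᵥ Projectivization.rep p = s * (z.rep ⬝ᵥ Projectivization.rep p) :=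
    mul_left_cancel₀ hu (by linear_combination hpl)
  have e2 : z.rep ⬝ᵥ Projectivization.rep p = t * (x.rep ⬝ᵥ Projectivization.rep p) :=
    mul_left_cancel₀ hv (by linear_combination hpm)
  rw [e1, e2]
  field_simp
  ring

/-! ### Freeness -/

namespace TriangleData

variable [IsAlgClosed K] {T : TriangleData K}

theorem isFreeWithExponents_iff_H_mem [CharZero K] :
    IsFreeWithExponents T.lines (T.fA.card + T.fB.card + 1) (T.fC.card + 1) ↔
      T.H ∈ Ideal.span {T.F, T.G} := by
  refine ⟨fun ⟨S⟩ => ?_, fun h => nonempty_splitting_of_H_mem h⟩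
  obtain ⟨σ, τ, hστ⟩ := S.exists_isGeneratingPair
  exact H_mem_of_isGeneratingPair hστ

theorem isCompleteIntersection_iff_H_mem {A B C : Plane K} (h : IsTriangle A B C T.x T.y T.z) :
    IsCompleteIntersection (innerTriplePoints A B C T.lines) T.fA.card T.fB.card ↔
      T.H ∈ Ideal.span {T.F, T.G} :=
  ⟨H_mem_of_isCompleteIntersection h, isCompleteIntersection_of_H_mem h⟩

theorem abs_sub_le_of_isFreeWithExponents [CharZero K] {d₁ d₂ : ℤ}
    (h : IsFreeWithExponents T.lines d₁ d₂) :
    |d₁ - d₂| ≤ |(T.fA.card + T.fB.card + 1 : ℤ) - (T.fC.card + 1)| := by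
  obtain ⟨S⟩ := h
  obtain ⟨σ, τ, hστ⟩ := S.exists_isGeneratingPair
  obtain ⟨h1, h2, h3⟩ := exponents_of_isGeneratingPair hστ
  rw [min_le_iff] at h2 h3
  grind

end TriangleData

end TriangularArrangement

end

theorem theorem2p2 (K : Type*) [Field K] [IsAlgClosed K] [CharZero K]
    (A B C : TriangularArrangement.Plane K)
    (hABC : Projectivization.Independent (K := K) (V := Fin 3 → K) ![A, B, C])
    (a b c : ℕ) :
    (∀ 𝒜 ∈ TriangularArrangement.Tr A B C a b c,
      (TriangularArrangement.IsFreeWithExponents 𝒜 ((a : ℤ) + b - 1) c ↔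
        TriangularArrangement.IsCompleteIntersection
          (TriangularArrangement.innerTriplePoints A B C 𝒜) (a - 1) (b - 1)) ∧
      (TriangularArrangement.innerTriplePoints A B C 𝒜).encard ≤ ((a - 1) * (b - 1) : ℕ) ∧
      (∀ d₁ d₂ : ℤ, TriangularArrangement.IsFreeWithExponents 𝒜 d₁ d₂ →
        |d₁ - d₂| ≤ |(a : ℤ) + b - 1 - c|)) ∧
    (1 ≤ a → 1 ≤ b → a ≤ c → b ≤ c →
      ∃ 𝒜 ∈ TriangularArrangement.Tr A B C a b c,
        TriangularArrangement.IsFreeWithExponents 𝒜 ((a : ℤ) + b - 1) c) := by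
  obtain ⟨x, y, z, h⟩ := TriangularArrangement.exists_isTriangle hABC
  have hcast : ∀ m n : ℕ, ((m + 1 : ℕ) : ℤ) + (n + 1 : ℕ) - 1 = m + n + 1 := by
    intro m n
    push_cast
    ring
  refine ⟨fun 𝒜 h𝒜 => ?_, fun ha hb hac hbc => ?_⟩
  · obtain ⟨T, hT, rfl, rfl, rfl, rfl⟩ := TriangularArrangement.exists_triangleData h h𝒜
    rw [hcast, Nat.add_sub_cancel, Nat.add_sub_cancel, Nat.cast_succ]
    exact ⟨T.isFreeWithExponents_iff_H_mem.trans (T.isCompleteIntersection_iff_H_mem hT).symm,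
      T.encard_innerTriplePoints_le hT, fun d₁ d₂ => T.abs_sub_le_of_isFreeWithExponents⟩
  · obtain ⟨T, hT, hA, hB, hC, hH⟩ := TriangularArrangement.exists_triangleData_H_mem h
      (a := a - 1) (b := b - 1) (c := c - 1) (by omega) (by omega)
    obtain rfl : a = T.fA.card + 1 := by omega
    obtain rfl : b = T.fB.card + 1 := by omega
    obtain rfl : c = T.fC.card + 1 := by omega
    refine ⟨T.lines, T.lines_mem_Tr hT, ?_⟩
    rw [hcast, Nat.cast_succ]
    exact T.isFreeWithExponents_iff_H_mem.mpr hH
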